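/- Let $k$ be an algebraically closed field of characteristic $p>0$ and let $H$ be a finite-dimensional connected Hopf algebra over $k$, that is, the coradical $H_0$ of $H$ (the sum of all simple subcoalgebras of $H$) is one-dimensional. Let $H_0\subseteq H_1\subseteq H_2\subseteq\cdots$ be the coradical filtration of $H$, defined by $H_{n+1}=\Delta^{-1}(H_0\otimes H+H\otimes H_n)$, and put $H_{-1}=0$. (1) Suppose that $H=\bigoplus_{n\ge 0}H(n)$ is a coradically graded Hopf algebra, that is, this decomposition is a grading of $H$ both as an algebra and as a coalgebra, the antipode maps each $H(n)$ into itself, and $H_n=\bigoplus_{m\le n}H(m)$ for all $n\ge 0$. Then for some $d\ge 0$ there is an isomorphism of $k$-algebras $$H\cong k[x_1,\dots,x_d]/(x_1^p,\dots,x_d^p).$$ (2) Without any assumption on gradings, let $\operatorname{gr}H=\bigoplus_{n\ge 0}H_n/H_{n-1}$ be the associated graded Hopf algebra of $H$, with the structure maps induced by those of $H$. Then for some $d\ge 0$ there is an isomorphism of $k$-algebras $$\operatorname{gr}H\cong k[x_1,\dots,x_d]/(x_1^p,\dots,x_d^p).$$ In particular, $\operatorname{gr}H$ is commutative. -/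

import Mathlib

namespace ConnHopf

open scoped TensorProduct DirectSum

universe u v

section Coalg

set_option linter.unusedSectionVars false

variable (k : Type u) (C : Type v) [Field k] [AddCommGroup C] [Module k C]

variable {k C} in
/-- The image of `X ⊗ Y` in `C ⊗ C`. -/
def tensorSub (X Y : Submodule k C) : Submodule k (C ⊗[k] C) :=
  Submodule.map₂ (TensorProduct.mk k C C) X Y

variable [Coalgebra k C]

variable {k C} in
/-- `D` is a subcoalgebra: `Δ(D) ⊆ D ⊗ D`. -/
def IsSubcoalgebra (D : Submodule k C) : Prop :=
  ∀ x ∈ D, Coalgebra.comul (R := k) x ∈ tensorSub D D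

variable {k C} in
/-- A nonzero subcoalgebra without subcoalgebras other than `0` and itself. -/
def IsSimpleSubcoalgebra (D : Submodule k C) : Prop :=
  IsSubcoalgebra D ∧ D ≠ ⊥ ∧ ∀ E : Submodule k C, IsSubcoalgebra E → E ≤ D → E = ⊥ ∨ E = D

/-- The coradical: the sum of all simple subcoalgebras. -/
def coradical : Submodule k C :=
  sSup {D : Submodule k C | IsSimpleSubcoalgebra D}

variable {k C} in
/-- The wedge `X ∧ Y = Δ⁻¹(X ⊗ C + C ⊗ Y)`. -/
def wedge (X Y : Submodule k C) : Submodule k C :=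
  (tensorSub X ⊤ ⊔ tensorSub ⊤ Y).comap Coalgebra.comul

/-- The coradical filtration: `C₀` is the coradical and
`Cₙ₊₁ = Δ⁻¹(C₀ ⊗ C + C ⊗ Cₙ)`. -/
def corad : ℕ → Submodule k C
  | 0 => coradical k C
  | n + 1 => wedge (coradical k C) (corad n)

/-- The coradical filtration with index lowered by one, `Cₙ₋₁`, where `C₋₁ = 0`. -/
def coradPred : ℕ → Submodule k C
  | 0 => ⊥
  | n + 1 => corad k C n

/-- A coalgebra is connected if its coradical is one-dimensional. -/
class IsConnectedCoalgebra : Prop where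
  finrank_coradical : Module.finrank k (coradical k C) = 1

variable {k C}

lemma tensorSub_mono {X X' Y Y' : Submodule k C} (h : X ≤ X') (h' : Y ≤ Y') :
    tensorSub X Y ≤ tensorSub X' Y' := Submodule.map₂_le_map₂ h h'

lemma tmul_mem_tensorSub {X Y : Submodule k C} {x y : C} (h : x ∈ X) (h' : y ∈ Y) :
    x ⊗ₜ[k] y ∈ tensorSub X Y := Submodule.apply_mem_map₂ _ h h'

lemma tensorSub_le {X Y : Submodule k C} {Z : Submodule k (C ⊗[k] C)}
    (h : ∀ x ∈ X, ∀ y ∈ Y, x ⊗ₜ[k] y ∈ Z) : tensorSub X Y ≤ Z := Submodule.map₂_le.2 h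

lemma range_lTensor_subtype (Y : Submodule k C) :
    LinearMap.range (Y.subtype.lTensor C) = tensorSub ⊤ Y := by
  rw [LinearMap.lTensor, TensorProduct.range_map]; simp [tensorSub]

lemma range_rTensor_subtype (Y : Submodule k C) :
    LinearMap.range (Y.subtype.rTensor C) = tensorSub Y ⊤ := by
  rw [LinearMap.rTensor, TensorProduct.range_map]; simp [tensorSub]

lemma ker_map_mkQ (X Y : Submodule k C) :
    LinearMap.ker (TensorProduct.map X.mkQ Y.mkQ) = tensorSub X ⊤ ⊔ tensorSub ⊤ Y := by
  rw [TensorProduct.map_ker (LinearMap.exact_subtype_mkQ X) X.mkQ_surjective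
      (LinearMap.exact_subtype_mkQ Y) Y.mkQ_surjective, range_lTensor_subtype,
      range_rTensor_subtype, sup_comm]

lemma mem_wedge {X Y : Submodule k C} {x : C} :
    x ∈ wedge X Y ↔ TensorProduct.map X.mkQ Y.mkQ (Coalgebra.comul (R := k) x) = 0 := by
  rw [wedge, Submodule.mem_comap, ← ker_map_mkQ, LinearMap.mem_ker]

lemma wedge_mono {X X' Y Y' : Submodule k C} (h : X ≤ X') (h' : Y ≤ Y') :
    wedge X Y ≤ wedge X' Y' :=
  Submodule.comap_mono (sup_le_sup (tensorSub_mono h le_rfl) (tensorSub_mono le_rfl h'))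

lemma wedge_assoc (X Y Z : Submodule k C) : wedge (wedge X Y) Z = wedge X (wedge Y Z) := by
  let f (A B : Submodule k C) : C →ₗ[k] (C ⧸ A) ⊗[k] (C ⧸ B) :=
    TensorProduct.map A.mkQ B.mkQ ∘ₗ Coalgebra.comul
  have hf (A B : Submodule k C) : LinearMap.ker (f A B) = wedge A B := by
    ext x; rw [LinearMap.mem_ker, mem_wedge]; rfl
  let g (A B : Submodule k C) : C ⧸ wedge A B →ₗ[k] (C ⧸ A) ⊗[k] (C ⧸ B) :=
    (wedge A B).liftQ (f A B) (hf A B).ge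
  have hg (A B : Submodule k C) : Function.Injective (g A B) := by
    rw [← LinearMap.ker_eq_bot]; exact Submodule.ker_liftQ_eq_bot _ _ _ (hf A B).le
  have hgc (A B : Submodule k C) : g A B ∘ₗ (wedge A B).mkQ = f A B := Submodule.liftQ_mkQ _ _ _
  have h1 (x : C) : x ∈ wedge (wedge X Y) Z ↔
      TensorProduct.map (f X Y) Z.mkQ (Coalgebra.comul (R := k) x) = 0 := by
    have h := Module.Flat.rTensor_preserves_injective_linearMap (M := C ⧸ Z) (g X Y) (hg X Y)
    rw [mem_wedge, ← map_eq_zero_iff _ h, ← LinearMap.comp_apply, LinearMap.rTensor,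
      ← TensorProduct.map_comp, hgc, LinearMap.id_comp]
  have h2 (x : C) : x ∈ wedge X (wedge Y Z) ↔
      TensorProduct.map X.mkQ (f Y Z) (Coalgebra.comul (R := k) x) = 0 := by
    have h := Module.Flat.lTensor_preserves_injective_linearMap (M := C ⧸ X) (g Y Z) (hg Y Z)
    rw [mem_wedge, ← map_eq_zero_iff _ h, ← LinearMap.comp_apply, LinearMap.lTensor,
      ← TensorProduct.map_comp, hgc, LinearMap.id_comp]
  ext x
  rw [h1, h2]
  have e1 : TensorProduct.map (f X Y) Z.mkQ (Coalgebra.comul (R := k) x) =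
      TensorProduct.map (TensorProduct.map X.mkQ Y.mkQ) Z.mkQ
        (Coalgebra.comul.rTensor C (Coalgebra.comul (R := k) x)) := by
    exact (LinearMap.congr_fun (LinearMap.map_comp_rTensor _ _ _ _) _).symm
  have e2 : TensorProduct.map X.mkQ (f Y Z) (Coalgebra.comul (R := k) x) =
      TensorProduct.map X.mkQ (TensorProduct.map Y.mkQ Z.mkQ)
        (Coalgebra.comul.lTensor C (Coalgebra.comul (R := k) x)) := by
    exact (LinearMap.congr_fun (LinearMap.map_comp_lTensor _ _ _ _) _).symm
  rw [e1, e2, ← Coalgebra.coassoc_apply, TensorProduct.map_map_assoc]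
  simp

lemma isSubcoalgebra_coradical : IsSubcoalgebra (coradical k C) := by
  intro x hx
  have : coradical k C ≤ (tensorSub (coradical k C) (coradical k C)).comap Coalgebra.comul := by
    refine sSup_le fun D hD y hy => ?_
    exact tensorSub_mono (le_sSup hD) (le_sSup hD) (hD.1 y hy)
  exact this hx

lemma corad_zero_le_left (X : Submodule k C) : corad k C 0 ≤ wedge (corad k C 0) X := fun x hx =>
  Submodule.mem_sup_left (tensorSub_mono le_rfl le_top (isSubcoalgebra_coradical x hx))

lemma corad_zero_le_right (X : Submodule k C) : corad k C 0 ≤ wedge X (corad k C 0) := fun x hx =>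
  Submodule.mem_sup_right (tensorSub_mono le_top le_rfl (isSubcoalgebra_coradical x hx))

lemma corad_wedge (a b : ℕ) : wedge (corad k C a) (corad k C b) = corad k C (a + b + 1) := by
  induction a with
  | zero => rw [zero_add]; rfl
  | succ a ih =>
    have : corad k C (a + 1) = wedge (corad k C 0) (corad k C a) := rfl
    rw [this, wedge_assoc, ih, show a + 1 + b + 1 = (a + b + 1) + 1 by ring]; rfl

lemma corad_mono : Monotone (corad k C) := by
  refine monotone_nat_of_le_succ fun n => ?_
  induction n with
  | zero => exact corad_zero_le_left _
  | succ n ih => exact wedge_mono le_rfl ih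

lemma coradPred_mono : Monotone (coradPred k C) := by
  refine monotone_nat_of_le_succ fun n => ?_
  cases n with
  | zero => exact bot_le
  | succ n => exact corad_mono (Nat.le_succ n)

lemma coradPred_le (n : ℕ) : coradPred k C n ≤ corad k C n := coradPred_mono (Nat.le_succ n)

lemma coradPred_le_wedge (a b : ℕ) :
    coradPred k C (a + b) ≤ wedge (coradPred k C a) (coradPred k C b) := by
  rcases a with _ | a <;> rcases b with _ | b
  · exact bot_le
  · rw [zero_add]
    change corad k C b ≤ wedge ⊥ (corad k C b)
    rcases b with _ | b
    · exact corad_zero_le_right _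
    · have h : corad k C (b + 1) = wedge (corad k C 0) (corad k C b) := rfl
      rw [h, ← wedge_assoc]
      exact wedge_mono (corad_zero_le_right _) le_rfl
  · rw [add_zero]
    change corad k C a ≤ wedge (corad k C a) ⊥
    rcases a with _ | a
    · exact corad_zero_le_left _
    · have h : corad k C (a + 1) = wedge (corad k C a) (corad k C 0) := (corad_wedge a 0).symm
      rw [h, wedge_assoc]
      exact wedge_mono le_rfl (corad_zero_le_left _)
  · change corad k C (a + 1 + b) ≤ wedge (corad k C a) (corad k C b)
    rw [corad_wedge]
    exact corad_mono (by omega)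

lemma tensor_modular {A B B' : Submodule k C} {t : C ⊗[k] C}
    (ht : t ∈ tensorSub ⊤ B) (h0 : TensorProduct.map A.mkQ B'.mkQ t = 0) :
    t ∈ tensorSub A B ⊔ tensorSub ⊤ B' := by
  rw [← range_lTensor_subtype] at ht
  obtain ⟨s, rfl⟩ := ht
  let B₁ : Submodule k B := B'.comap B.subtype
  let φ : B ⧸ B₁ →ₗ[k] C ⧸ B' := B₁.mapQ B' B.subtype le_rfl
  have hφ : Function.Injective φ := by
    rw [← LinearMap.ker_eq_bot]
    exact Submodule.ker_liftQ_eq_bot _ _ _ (by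
      intro x hx
      simpa [B₁] using hx)
  have hφc : φ ∘ₗ B₁.mkQ = B'.mkQ ∘ₗ B.subtype := rfl
  have h := Module.Flat.lTensor_preserves_injective_linearMap (M := C ⧸ A) φ hφ
  have hs : TensorProduct.map A.mkQ B₁.mkQ s = 0 := by
    rw [← map_eq_zero_iff _ h, ← LinearMap.comp_apply, LinearMap.lTensor,
      ← TensorProduct.map_comp, hφc, LinearMap.id_comp, ← h0, LinearMap.lTensor,
      ← LinearMap.comp_apply, ← TensorProduct.map_comp, LinearMap.comp_id]
  rw [← LinearMap.mem_ker, TensorProduct.map_ker (LinearMap.exact_subtype_mkQ A) A.mkQ_surjective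
      (LinearMap.exact_subtype_mkQ B₁) B₁.mkQ_surjective, LinearMap.lTensor, LinearMap.rTensor,
      TensorProduct.range_map, TensorProduct.range_map] at hs
  have hle : Submodule.map₂ (TensorProduct.mk k C B) (LinearMap.range LinearMap.id)
      (LinearMap.range B₁.subtype) ⊔ Submodule.map₂ (TensorProduct.mk k C B)
      (LinearMap.range A.subtype) (LinearMap.range LinearMap.id) ≤
      (tensorSub A B ⊔ tensorSub ⊤ B').comap (B.subtype.lTensor C) := by
    refine sup_le (Submodule.map₂_le.2 ?_) (Submodule.map₂_le.2 ?_)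
    · rintro x - y hy
      refine Submodule.mem_sup_right ?_
      refine tmul_mem_tensorSub trivial ?_
      rw [Submodule.range_subtype] at hy
      exact hy
    · rintro x hx y -
      refine Submodule.mem_sup_left ?_
      refine tmul_mem_tensorSub ?_ y.2
      rwa [Submodule.range_subtype] at hx
  exact hle hs

lemma mem_iSup_of_forall_ker {N : ℕ} {t : C ⊗[k] C}
    (h : ∀ a b, a + b = N →
      TensorProduct.map (coradPred k C a).mkQ (coradPred k C b).mkQ t = 0) :
    ∀ m ≤ N, t ∈ (⨆ p : {p : ℕ × ℕ // p.1 + p.2 + 1 = N},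
      tensorSub (corad k C p.1.1) (corad k C p.1.2)) ⊔ tensorSub ⊤ (coradPred k C (N - m)) := by
  intro m
  induction m with
  | zero =>
    intro _
    have h1 := h 0 N (zero_add N)
    rw [← LinearMap.mem_ker, ker_map_mkQ] at h1
    have h2 : tensorSub (coradPred k C 0) ⊤ = (⊥ : Submodule k (C ⊗[k] C)) := by
      change Submodule.map₂ _ ⊥ ⊤ = ⊥
      simp
    rw [h2, bot_sup_eq] at h1
    exact Submodule.mem_sup_right h1
  | succ m ih =>
    intro hm
    obtain ⟨s, hs, r, hr, rfl⟩ := Submodule.mem_sup.1 (ih (by omega))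
    have h1 := h (m + 1) (N - (m + 1)) (by omega)
    have hs0 : TensorProduct.map (coradPred k C (m + 1)).mkQ
        (coradPred k C (N - (m + 1))).mkQ s = 0 := by
      rw [← LinearMap.mem_ker, ker_map_mkQ]
      refine SetLike.le_def.1 (iSup_le ?_) hs
      rintro ⟨⟨i, j⟩, hij⟩
      by_cases hi : i ≤ m
      · exact le_sup_of_le_left (tensorSub_mono (corad_mono hi) le_top)
      · refine le_sup_of_le_right (tensorSub_mono le_top ?_)
        exact coradPred_mono (show j + 1 ≤ N - (m + 1) by simp only at hij; omega)
    rw [map_add, hs0, zero_add] at h1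
    have h2 := tensor_modular hr h1
    refine add_mem (Submodule.mem_sup_left hs) (SetLike.le_def.1 (sup_le_sup_right ?_ _) h2)
    have e : N - m = (N - m - 1) + 1 := by omega
    rw [e]
    exact le_iSup (fun p : {p : ℕ × ℕ // p.1 + p.2 + 1 = N} =>
      tensorSub (corad k C p.1.1) (corad k C p.1.2)) ⟨(m, N - m - 1), by simp only; omega⟩

/-- `Δ(Cₙ) ⊆ ∑ Cᵢ ⊗ Cₙ₋ᵢ`. -/
lemma comul_mem {n : ℕ} {x : C} (hx : x ∈ corad k C n) :
    Coalgebra.comul (R := k) x ∈ ⨆ p : {p : ℕ × ℕ // p.1 + p.2 + 1 = n + 1},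
      tensorSub (corad k C p.1.1) (corad k C p.1.2) := by
  have h := mem_iSup_of_forall_ker (N := n + 1) (t := Coalgebra.comul (R := k) x)
    (fun a b hab => mem_wedge.1 (coradPred_le_wedge a b (by rw [hab]; exact hx))) (n + 1) le_rfl
  have h2 : tensorSub ⊤ (coradPred k C (n + 1 - (n + 1))) = (⊥ : Submodule k (C ⊗[k] C)) := by
    rw [Nat.sub_self]
    change Submodule.map₂ _ ⊤ ⊥ = ⊥
    simp
  rwa [h2, sup_bot_eq] at h

lemma comul_mem_of {n : ℕ} {Z : Submodule k (C ⊗[k] C)}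
    (h : ∀ i j, i + j = n → ∀ u ∈ corad k C i, ∀ v ∈ corad k C j, u ⊗ₜ[k] v ∈ Z)
    {x : C} (hx : x ∈ corad k C n) : Coalgebra.comul (R := k) x ∈ Z := by
  refine (iSup_le ?_ : _ ≤ Z) (comul_mem hx)
  rintro ⟨⟨i, j⟩, hij⟩
  exact tensorSub_le fun u hu v hv => h i j (by simp only at hij; omega) u hu v hv

lemma comul_ext {V : Type*} [AddCommMonoid V] [Module k V] {n : ℕ} (f g : C ⊗[k] C →ₗ[k] V)
    (h : ∀ i j, i + j = n → ∀ u ∈ corad k C i, ∀ v ∈ corad k C j, f (u ⊗ₜ[k] v) = g (u ⊗ₜ[k] v))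
    {x : C} (hx : x ∈ corad k C n) :
    f (Coalgebra.comul (R := k) x) = g (Coalgebra.comul (R := k) x) :=
  comul_mem_of (Z := LinearMap.eqLocus f g) h hx


variable (k C) in
/-- The component `Cₙ / Cₙ₋₁` of the associated graded space. -/
def GrComp (n : ℕ) : Type v := corad k C n ⧸ (coradPred k C n).submoduleOf (corad k C n)

instance (n : ℕ) : AddCommGroup (GrComp k C n) :=
  inferInstanceAs (AddCommGroup (corad k C n ⧸ (coradPred k C n).submoduleOf (corad k C n)))

instance (n : ℕ) : Module k (GrComp k C n) :=
  inferInstanceAs (Module k (corad k C n ⧸ (coradPred k C n).submoduleOf (corad k C n)))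

variable (k C) in
/-- The quotient map `Cₙ → Cₙ / Cₙ₋₁`. -/
def grMk (n : ℕ) : corad k C n →ₗ[k] GrComp k C n :=
  ((coradPred k C n).submoduleOf (corad k C n)).mkQ

lemma grMk_surjective (n : ℕ) : Function.Surjective (grMk k C n) :=
  Submodule.mkQ_surjective _

lemma grMk_eq_zero {n : ℕ} {x : corad k C n} : grMk k C n x = 0 ↔ (x : C) ∈ coradPred k C n :=
  Submodule.Quotient.mk_eq_zero ((coradPred k C n).submoduleOf (corad k C n))

variable (k C) in
/-- The linear map on `Cₙ / Cₙ₋₁` induced by a linear map on `Cₙ` that vanishes on `Cₙ₋₁`. -/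
def grLift {V : Type*} [AddCommGroup V] [Module k V] (n : ℕ) (f : corad k C n →ₗ[k] V)
    (hf : ∀ x : corad k C n, (x : C) ∈ coradPred k C n → f x = 0) : GrComp k C n →ₗ[k] V :=
  ((coradPred k C n).submoduleOf (corad k C n)).liftQ f fun x hx => hf x hx

lemma grLift_grMk {V : Type*} [AddCommGroup V] [Module k V] (n : ℕ) (f : corad k C n →ₗ[k] V)
    (hf : ∀ x : corad k C n, (x : C) ∈ coradPred k C n → f x = 0) (x : corad k C n) :
    grLift k C n f hf (grMk k C n x) = f x := rfl

variable (k C) in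
/-- The associated graded space `gr C = ⨁ₙ Cₙ / Cₙ₋₁` of the coradical filtration. -/
abbrev Gr : Type v := ⨁ n, GrComp k C n

lemma exists_proj (n : ℕ) : ∃ q : C →ₗ[k] GrComp k C n,
    q ∘ₗ (corad k C n).subtype = grMk k C n :=
  LinearMap.exists_extend _

variable (k C) in
/-- A linear map `C → gr C` which on `Cₙ` is the canonical map onto `Cₙ / Cₙ₋₁`, extended to `C`
in an arbitrary way. It is only used where the result does not depend on the extension. -/
noncomputable def symb (n : ℕ) : C →ₗ[k] Gr k C :=
  DirectSum.lof k ℕ (GrComp k C) n ∘ₗ (exists_proj n).choose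

lemma symb_apply {n : ℕ} (x : corad k C n) :
    symb k C n x = DirectSum.lof k ℕ (GrComp k C) n (grMk k C n x) := by
  have h := LinearMap.congr_fun (exists_proj (k := k) (C := C) n).choose_spec x
  exact congrArg (DirectSum.lof k ℕ (GrComp k C) n) h

lemma symb_eq_zero_of_mem {n : ℕ} {x : C} (hx : x ∈ coradPred k C n) : symb k C n x = 0 := by
  have h := symb_apply (⟨x, coradPred_le n hx⟩ : corad k C n)
  rw [grMk_eq_zero.2 hx, map_zero] at h
  exact h

lemma symb_eq_zero {i j : ℕ} (h : j < i) {x : C} (hx : x ∈ corad k C j) : symb k C i x = 0 :=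
  symb_eq_zero_of_mem (coradPred_mono (show j + 1 ≤ i from h) hx)

variable (k C) in
/-- On `∑_{i + j = n} Cᵢ ⊗ Cⱼ` this is the canonical map onto
`⨁_{i + j = n} Cᵢ / Cᵢ₋₁ ⊗ Cⱼ / Cⱼ₋₁`, see `symb₂_tmul`. -/
noncomputable def symb₂ (n : ℕ) : C ⊗[k] C →ₗ[k] Gr k C ⊗[k] Gr k C :=
  ∑ p ∈ Finset.HasAntidiagonal.antidiagonal n, TensorProduct.map (symb k C p.1) (symb k C p.2)

lemma symb₂_apply (n : ℕ) (t : C ⊗[k] C) : symb₂ k C n t =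
    ∑ p ∈ Finset.HasAntidiagonal.antidiagonal n, TensorProduct.map (symb k C p.1) (symb k C p.2) t := by
  simp [symb₂]

lemma symb_tmul_eq_zero {i j a b : ℕ} (hij : i + j ≤ a + b) (hne : (i, j) ≠ (a, b)) {u v : C}
    (hu : u ∈ corad k C i) (hv : v ∈ corad k C j) : symb k C a u ⊗ₜ[k] symb k C b v = 0 := by
  rcases lt_or_ge i a with h | h
  · rw [symb_eq_zero h hu, TensorProduct.zero_tmul]
  · rw [symb_eq_zero (i := b) (j := j) _ hv, TensorProduct.tmul_zero]
    by_contra hb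
    exact hne (Prod.ext (by simp only; omega) (by simp only; omega))

lemma symb₂_tmul {i j : ℕ} {u v : C} (hu : u ∈ corad k C i) (hv : v ∈ corad k C j) :
    symb₂ k C (i + j) (u ⊗ₜ[k] v) = symb k C i u ⊗ₜ[k] symb k C j v := by
  rw [symb₂_apply, Finset.sum_eq_single (i, j)]
  · rfl
  · rintro ⟨a, b⟩ hab hne
    rw [Finset.HasAntidiagonal.mem_antidiagonal] at hab
    exact symb_tmul_eq_zero hab.ge hne.symm hu hv
  · intro h
    simp at h

lemma symb₂_comul_eq_zero {n : ℕ} {x : C} (hx : x ∈ coradPred k C n) :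
    symb₂ k C n (Coalgebra.comul x) = 0 := by
  rcases n with _ | n
  · rw [(Submodule.mem_bot k).1 hx, map_zero, map_zero]
  · refine (comul_ext (symb₂ k C (n + 1)) 0 ?_ hx)
    intro i j hij u hu v hv
    rw [symb₂_apply]
    refine Finset.sum_eq_zero ?_
    rintro ⟨a, b⟩ hab
    rw [Finset.HasAntidiagonal.mem_antidiagonal] at hab
    exact symb_tmul_eq_zero (by simp only at hab; omega) (by rintro ⟨⟩; simp only at hab; omega)
      hu hv

variable (k C) in
/-- The comultiplication of `gr C`: if `x ∈ Cₙ` and `Δ(x) = ∑ u ⊗ v` with `u ∈ Cᵢ`, `v ∈ Cⱼ`,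
`i + j = n`, then the class of `x` in `Cₙ / Cₙ₋₁` is sent to the sum of the tensors of the class
of `u` in `Cᵢ / Cᵢ₋₁` and the class of `v` in `Cⱼ / Cⱼ₋₁`. -/
noncomputable def grComul : Gr k C →ₗ[k] Gr k C ⊗[k] Gr k C :=
  DirectSum.toModule k ℕ _ fun n =>
    grLift k C n (symb₂ k C n ∘ₗ Coalgebra.comul ∘ₗ (corad k C n).subtype)
      (fun _ hx => symb₂_comul_eq_zero hx)

variable (k C) in
/-- The counit of `gr C`: the counit of `C` on `C₀`, and zero in positive degrees. -/
noncomputable def grCounit : Gr k C →ₗ[k] k :=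
  DirectSum.toModule k ℕ _ fun n =>
    grLift k C n (if n = 0 then Coalgebra.counit ∘ₗ (corad k C n).subtype else 0)
      (fun x hx => by
        rcases n with _ | n
        · obtain rfl : x = 0 := Subtype.ext ((Submodule.mem_bot k).1 hx)
          simp
        · simp)

lemma grComul_symb {n : ℕ} {x : C} (hx : x ∈ corad k C n) :
    grComul k C (symb k C n x) = symb₂ k C n (Coalgebra.comul x) := by
  have h := symb_apply (⟨x, hx⟩ : corad k C n)
  simp only at h
  rw [h, grComul, DirectSum.toModule_lof, grLift_grMk]
  rfl

lemma grCounit_symb_zero {x : C} (hx : x ∈ corad k C 0) :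
    grCounit k C (symb k C 0 x) = Coalgebra.counit x := by
  have h := symb_apply (⟨x, hx⟩ : corad k C 0)
  simp only at h
  rw [h, grCounit, DirectSum.toModule_lof, grLift_grMk]
  rfl

lemma grCounit_symb {n : ℕ} (hn : n ≠ 0) {x : C} (hx : x ∈ corad k C n) :
    grCounit k C (symb k C n x) = 0 := by
  have h := symb_apply (⟨x, hx⟩ : corad k C n)
  simp only at h
  rw [h, grCounit, DirectSum.toModule_lof, grLift_grMk]
  simp [hn]

lemma gr_ext {V : Type*} [AddCommMonoid V] [Module k V] {f g : Gr k C →ₗ[k] V}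
    (h : ∀ n, ∀ x ∈ corad k C n, f (symb k C n x) = g (symb k C n x)) : f = g := by
  refine DirectSum.linearMap_ext k fun n => LinearMap.ext fun y => ?_
  obtain ⟨x, rfl⟩ := grMk_surjective _ y
  have := h n x x.2
  rw [symb_apply] at this
  exact this

lemma gr_induction {P : Gr k C → Prop} (h0 : P 0) (hadd : ∀ a b, P a → P b → P (a + b))
    (h : ∀ n, ∀ x ∈ corad k C n, P (symb k C n x)) (a : Gr k C) : P a := by
  induction a using DirectSum.induction_on with
  | zero => exact h0
  | add a b ha hb => exact hadd a b ha hb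
  | of n x =>
    obtain ⟨y, rfl⟩ := grMk_surjective _ x
    have := h n y y.2
    rw [symb_apply] at this
    exact this

lemma comul_symb_left {n : ℕ} {p : ℕ × ℕ} (hp : p.1 + p.2 = n) {x : C} (hx : x ∈ corad k C n) :
    (grComul k C).rTensor _ (TensorProduct.map (symb k C p.1) (symb k C p.2) (Coalgebra.comul x)) =
    TensorProduct.map (symb₂ k C p.1) (symb k C p.2)
      (Coalgebra.comul.rTensor C (Coalgebra.comul (R := k) x)) := by
  refine comul_ext ((grComul k C).rTensor _ ∘ₗ TensorProduct.map (symb k C p.1) (symb k C p.2))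
    (TensorProduct.map (symb₂ k C p.1) (symb k C p.2) ∘ₗ Coalgebra.comul.rTensor C) ?_ hx
  intro i j hij u hu v hv
  simp only [LinearMap.comp_apply, TensorProduct.map_tmul, LinearMap.rTensor_tmul]
  rcases le_or_gt i p.1 with h | h
  · rw [grComul_symb (corad_mono h hu)]
  · rw [symb_eq_zero (i := p.2) (j := j) (by omega) hv]
    simp

lemma comul_symb_right {n : ℕ} {p : ℕ × ℕ} (hp : p.1 + p.2 = n) {x : C} (hx : x ∈ corad k C n) :
    (grComul k C).lTensor _ (TensorProduct.map (symb k C p.1) (symb k C p.2) (Coalgebra.comul x)) =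
    TensorProduct.map (symb k C p.1) (symb₂ k C p.2)
      (Coalgebra.comul.lTensor C (Coalgebra.comul (R := k) x)) := by
  refine comul_ext ((grComul k C).lTensor _ ∘ₗ TensorProduct.map (symb k C p.1) (symb k C p.2))
    (TensorProduct.map (symb k C p.1) (symb₂ k C p.2) ∘ₗ Coalgebra.comul.lTensor C) ?_ hx
  intro i j hij u hu v hv
  simp only [LinearMap.comp_apply, TensorProduct.map_tmul, LinearMap.lTensor_tmul]
  rcases le_or_gt j p.2 with h | h
  · rw [grComul_symb (corad_mono h hv)]
  · rw [symb_eq_zero (i := p.1) (j := i) (by omega) hu]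
    simp

lemma sum_antidiagonal_assoc {V : Type*} [AddCommMonoid V] (n : ℕ) (f : ℕ → ℕ → ℕ → V) :
    ∑ p ∈ Finset.HasAntidiagonal.antidiagonal n, ∑ q ∈ Finset.HasAntidiagonal.antidiagonal p.1,
      f q.1 q.2 p.2 =
    ∑ p ∈ Finset.HasAntidiagonal.antidiagonal n, ∑ q ∈ Finset.HasAntidiagonal.antidiagonal p.2,
      f p.1 q.1 q.2 := by
  rw [Finset.sum_sigma', Finset.sum_sigma']
  refine Finset.sum_bij' (fun a _ => ⟨(a.2.1, a.2.2 + a.1.2), (a.2.2, a.1.2)⟩)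
    (fun a _ => ⟨(a.1.1 + a.2.1, a.2.2), (a.1.1, a.2.1)⟩) ?_ ?_ ?_ ?_ ?_
  · rintro ⟨⟨a, b⟩, ⟨c, d⟩⟩ h
    simp only [Finset.mem_sigma, Finset.HasAntidiagonal.mem_antidiagonal] at h ⊢
    obtain ⟨h1, h2⟩ := h
    exact ⟨by omega, trivial⟩
  · rintro ⟨⟨a, b⟩, ⟨c, d⟩⟩ h
    simp only [Finset.mem_sigma, Finset.HasAntidiagonal.mem_antidiagonal] at h ⊢
    obtain ⟨h1, h2⟩ := h
    exact ⟨by omega, trivial⟩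
  · rintro ⟨⟨a, b⟩, ⟨c, d⟩⟩ h
    simp only [Finset.mem_sigma, Finset.HasAntidiagonal.mem_antidiagonal] at h
    obtain ⟨-, rfl⟩ := h
    rfl
  · rintro ⟨⟨a, b⟩, ⟨c, d⟩⟩ h
    simp only [Finset.mem_sigma, Finset.HasAntidiagonal.mem_antidiagonal] at h
    obtain ⟨-, rfl⟩ := h
    rfl
  · rintro ⟨⟨a, b⟩, ⟨c, d⟩⟩ h
    rfl

variable (k C) in
lemma map_symb₂_left (m b : ℕ) : TensorProduct.map (symb₂ k C m) (symb k C b) =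
    ∑ q ∈ Finset.HasAntidiagonal.antidiagonal m,
      TensorProduct.map (TensorProduct.map (symb k C q.1) (symb k C q.2)) (symb k C b) := by
  simp only [symb₂, ← TensorProduct.mapBilinear_apply, map_sum, LinearMap.sum_apply]

variable (k C) in
lemma map_symb₂_right (m b : ℕ) : TensorProduct.map (symb k C b) (symb₂ k C m) =
    ∑ q ∈ Finset.HasAntidiagonal.antidiagonal m,
      TensorProduct.map (symb k C b) (TensorProduct.map (symb k C q.1) (symb k C q.2)) := by
  simp only [symb₂, ← TensorProduct.mapBilinear_apply, map_sum]

noncomputable instance instCoalgebraGr : Coalgebra k (Gr k C) where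
  comul := grComul k C
  counit := grCounit k C
  coassoc := by
    refine gr_ext fun n x hx => ?_
    simp only [LinearMap.comp_apply]
    rw [grComul_symb hx, symb₂_apply]
    simp only [map_sum]
    have e1 : ∀ p ∈ Finset.HasAntidiagonal.antidiagonal n, (TensorProduct.assoc k (Gr k C) (Gr k C) (Gr k C))
        ((grComul k C).rTensor _
          (TensorProduct.map (symb k C p.1) (symb k C p.2) (Coalgebra.comul x))) =
        ∑ q ∈ Finset.HasAntidiagonal.antidiagonal p.1, TensorProduct.map (symb k C q.1)
          (TensorProduct.map (symb k C q.2) (symb k C p.2))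
          (Coalgebra.comul.lTensor C (Coalgebra.comul (R := k) x)) := by
      intro p hp
      rw [comul_symb_left (Finset.HasAntidiagonal.mem_antidiagonal.1 hp) hx, map_symb₂_left]
      simp only [LinearMap.sum_apply, map_sum]
      refine Finset.sum_congr rfl fun q _ => ?_
      rw [← Coalgebra.coassoc_apply, TensorProduct.map_map_assoc]
    have e2 : ∀ p ∈ Finset.HasAntidiagonal.antidiagonal n, (grComul k C).lTensor _
          (TensorProduct.map (symb k C p.1) (symb k C p.2) (Coalgebra.comul x)) =
        ∑ q ∈ Finset.HasAntidiagonal.antidiagonal p.2, TensorProduct.map (symb k C p.1)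
          (TensorProduct.map (symb k C q.1) (symb k C q.2))
          (Coalgebra.comul.lTensor C (Coalgebra.comul (R := k) x)) := by
      intro p hp
      rw [comul_symb_right (Finset.HasAntidiagonal.mem_antidiagonal.1 hp) hx, map_symb₂_right]
      simp only [LinearMap.sum_apply]
    refine (Finset.sum_congr rfl e1).trans (Eq.trans ?_ (Finset.sum_congr rfl e2).symm)
    exact sum_antidiagonal_assoc n fun a b c => TensorProduct.map (symb k C a)
          (TensorProduct.map (symb k C b) (symb k C c))
          (Coalgebra.comul.lTensor C (Coalgebra.comul (R := k) x))
  rTensor_counit_comp_comul := by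
    refine gr_ext fun n x hx => ?_
    rw [LinearMap.comp_apply, grComul_symb hx]
    have h := comul_ext ((grCounit k C).rTensor _ ∘ₗ symb₂ k C n)
      (TensorProduct.map LinearMap.id (symb k C n) ∘ₗ Coalgebra.counit.rTensor C) ?_ hx
    · simp only [LinearMap.comp_apply] at h
      rw [h, Coalgebra.rTensor_counit_comul]
      rfl
    · rintro i j rfl u hu v hv
      rw [LinearMap.comp_apply, symb₂_tmul hu hv]
      simp only [LinearMap.comp_apply, LinearMap.rTensor_tmul, TensorProduct.map_tmul]
      rcases Nat.eq_zero_or_pos i with rfl | hi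
      · rw [grCounit_symb_zero hu, zero_add]; rfl
      · rw [grCounit_symb hi.ne' hu, symb_eq_zero (j := j) (i := i + j) (by omega) hv]; simp
  lTensor_counit_comp_comul := by
    refine gr_ext fun n x hx => ?_
    rw [LinearMap.comp_apply, grComul_symb hx]
    have h := comul_ext ((grCounit k C).lTensor _ ∘ₗ symb₂ k C n)
      (TensorProduct.map (symb k C n) LinearMap.id ∘ₗ Coalgebra.counit.lTensor C) ?_ hx
    · simp only [LinearMap.comp_apply] at h
      rw [h, Coalgebra.lTensor_counit_comul]
      rfl
    · rintro i j rfl u hu v hv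
      rw [LinearMap.comp_apply, symb₂_tmul hu hv]
      simp only [LinearMap.comp_apply, LinearMap.lTensor_tmul, TensorProduct.map_tmul]
      rcases Nat.eq_zero_or_pos j with rfl | hj
      · rw [grCounit_symb_zero hv, add_zero]; rfl
      · rw [grCounit_symb hj.ne' hv, symb_eq_zero (j := i) (i := i + j) (by omega) hu]; simp

end Coalg

section Bialg

set_option linter.unusedSectionVars false

variable {k : Type u} {A : Type v} [Field k] [Ring A] [Bialgebra k A]

lemma one_mem_coradical : (1 : A) ∈ coradical k A := by
  have h1 : (1 : A) ≠ 0 := by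
    intro h
    have := Bialgebra.counit_one (R := k) (A := A)
    rw [h, map_zero] at this
    exact zero_ne_one this
  have hs : IsSimpleSubcoalgebra (Submodule.span k {(1 : A)}) := by
    refine ⟨fun x hx => ?_, ?_, fun E _ hE => ?_⟩
    · obtain ⟨c, rfl⟩ := Submodule.mem_span_singleton.1 hx
      rw [map_smul, Bialgebra.comul_one]
      exact Submodule.smul_mem _ _ (tmul_mem_tensorSub (Submodule.mem_span_singleton_self _)
        (Submodule.mem_span_singleton_self _))
    · simpa using h1
    · rcases eq_or_ne E ⊥ with h | h
      · exact Or.inl h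
      · refine Or.inr (le_antisymm hE ?_)
        obtain ⟨x, hx, hx0⟩ := E.ne_bot_iff.1 h
        obtain ⟨c, rfl⟩ := Submodule.mem_span_singleton.1 (hE hx)
        have hc : c ≠ 0 := by rintro rfl; simp at hx0
        rw [Submodule.span_singleton_le_iff_mem]
        exact (Submodule.smul_mem_iff _ hc).1 hx
  exact (le_sSup hs : _ ≤ coradical k A) (Submodule.mem_span_singleton_self _)

lemma one_mem_corad : (1 : A) ∈ corad k A 0 := one_mem_coradical

variable [hA : IsConnectedCoalgebra k A]

lemma exists_smul_one {x : A} (hx : x ∈ corad k A 0) : ∃ c : k, x = c • (1 : A) := by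
  have h1 : (⟨1, one_mem_coradical⟩ : coradical k A) ≠ 0 := by
    intro h
    have h0 : (1 : A) = 0 := congrArg Subtype.val h
    have := Bialgebra.counit_one (R := k) (A := A)
    rw [h0, map_zero] at this
    exact zero_ne_one this
  obtain ⟨c, hc⟩ := exists_smul_eq_of_finrank_eq_one hA.finrank_coradical h1 ⟨x, hx⟩
  exact ⟨c, (congrArg Subtype.val hc).symm⟩

lemma mul_mem_corad {m n : ℕ} {x y : A} (hx : x ∈ corad k A m) (hy : y ∈ corad k A n) :
    x * y ∈ corad k A (m + n) := by
  induction hN : m + n using Nat.strong_induction_on generalizing m n x y with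
  | _ N ih =>
  subst hN
  rcases m with _ | m
  · obtain ⟨c, rfl⟩ := exists_smul_one hx
    rw [smul_mul_assoc, one_mul, zero_add]
    exact Submodule.smul_mem _ _ hy
  rcases n with _ | n
  · obtain ⟨c, rfl⟩ := exists_smul_one hy
    rw [mul_smul_comm, mul_one, add_zero]
    exact Submodule.smul_mem _ _ hx
  rw [show m + 1 + (n + 1) = (m + 1 + n) + 1 by ring]
  change Coalgebra.comul (R := k) (x * y) ∈ tensorSub (corad k A 0) ⊤ ⊔
    tensorSub ⊤ (corad k A (m + 1 + n))
  rw [Bialgebra.comul_mul]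
  refine comul_mem_of (Z := (tensorSub (corad k A 0) ⊤ ⊔ tensorSub ⊤ (corad k A (m + 1 + n))).comap
    (LinearMap.mulRight k (Coalgebra.comul (R := k) y))) ?_ hx
  intro i j hij u hu v hv
  refine comul_mem_of (Z := (tensorSub (corad k A 0) ⊤ ⊔ tensorSub ⊤ (corad k A (m + 1 + n))).comap
    (LinearMap.mulLeft k (u ⊗ₜ[k] v))) ?_ hy
  intro i' j' hij' u' hu' v' hv'
  rw [Submodule.mem_comap, LinearMap.mulLeft_apply]
  rw [Algebra.TensorProduct.tmul_mul_tmul]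
  by_cases h : i + i' = 0
  · refine Submodule.mem_sup_left (tmul_mem_tensorSub ?_ trivial)
    obtain rfl : i = 0 := by omega
    obtain rfl : i' = 0 := by omega
    obtain ⟨c, rfl⟩ := exists_smul_one hu
    rw [smul_mul_assoc, one_mul]
    exact Submodule.smul_mem _ _ hu'
  · refine Submodule.mem_sup_right (tmul_mem_tensorSub trivial ?_)
    exact corad_mono (by omega) (ih (j + j') (by omega) hv hv' rfl)

lemma mul_mem_coradPred_left {m n : ℕ} {x y : A} (hx : x ∈ coradPred k A m)
    (hy : y ∈ corad k A n) : x * y ∈ coradPred k A (m + n) := by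
  rcases m with _ | m
  · rw [(Submodule.mem_bot k).1 hx, zero_mul]
    exact zero_mem _
  · rw [show m + 1 + n = m + n + 1 by ring]
    exact mul_mem_corad hx hy

lemma mul_mem_coradPred_right {m n : ℕ} {x y : A} (hx : x ∈ corad k A m)
    (hy : y ∈ coradPred k A n) : x * y ∈ coradPred k A (m + n) := by
  rcases n with _ | n
  · rw [(Submodule.mem_bot k).1 hy, mul_zero]
    exact zero_mem _
  · exact mul_mem_corad hx hy

variable (k A) in
/-- The product `Cᵢ / Cᵢ₋₁ × Cⱼ / Cⱼ₋₁ → Cᵢ₊ⱼ / Cᵢ₊ⱼ₋₁` sending the classes of `x` and `y` to the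
class of `x * y`. -/
def grMul (i j : ℕ) : GrComp k A i →ₗ[k] GrComp k A j →ₗ[k] GrComp k A (i + j) :=
  grLift k A i
    { toFun := fun x => grLift k A j
        { toFun := fun y => grMk k A (i + j) ⟨x * y, mul_mem_corad x.2 y.2⟩
          map_add' := fun y z => by
            rw [← map_add]; exact congrArg _ (Subtype.ext (mul_add _ _ _))
          map_smul' := fun c y => by
            rw [RingHom.id_apply, ← map_smul]
            exact congrArg _ (Subtype.ext (mul_smul_comm _ _ _)) }
        (fun y hy => grMk_eq_zero.2 (mul_mem_coradPred_right x.2 hy))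
      map_add' := fun x z => by
        ext y
        obtain ⟨y, rfl⟩ := grMk_surjective _ y
        simp only [LinearMap.add_apply, grLift_grMk, LinearMap.coe_mk, AddHom.coe_mk]
        rw [← map_add]; exact congrArg _ (Subtype.ext (add_mul _ _ _))
      map_smul' := fun c x => by
        ext y
        obtain ⟨y, rfl⟩ := grMk_surjective _ y
        simp only [RingHom.id_apply, LinearMap.smul_apply, grLift_grMk, LinearMap.coe_mk,
          AddHom.coe_mk]
        rw [← map_smul]; exact congrArg _ (Subtype.ext (smul_mul_assoc _ _ _)) }
    (fun x hx => by
      ext y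
      obtain ⟨y, rfl⟩ := grMk_surjective _ y
      exact grMk_eq_zero.2 (mul_mem_coradPred_left hx y.2))

lemma grMul_grMk {i j : ℕ} (x : corad k A i) (y : corad k A j) :
    grMul k A i j (grMk k A i x) (grMk k A j y) =
      grMk k A (i + j) ⟨x * y, mul_mem_corad x.2 y.2⟩ := rfl

instance : GradedMonoid.GOne (GrComp k A) := ⟨grMk k A 0 ⟨1, one_mem_corad⟩⟩

instance : GradedMonoid.GMul (GrComp k A) := ⟨fun {i j} a b => grMul k A i j a b⟩

lemma graded_ext {i j : ℕ} (h : i = j) {x : corad k A i} {y : corad k A j}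
    (hxy : (x : A) = y) :
    (⟨i, grMk k A i x⟩ : GradedMonoid (GrComp k A)) = ⟨j, grMk k A j y⟩ := by
  subst h
  rw [Subtype.ext hxy]

instance instGRingGr : DirectSum.GRing (GrComp k A) where
  mul_zero a := map_zero (grMul k A _ _ a)
  zero_mul b := by
    change grMul k A _ _ 0 b = 0
    rw [map_zero, LinearMap.zero_apply]
  mul_add a b c := map_add (grMul k A _ _ a) b c
  add_mul a b c := by
    change grMul k A _ _ (a + b) c = grMul k A _ _ a c + grMul k A _ _ b c
    rw [map_add, LinearMap.add_apply]
  one_mul := by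
    rintro ⟨i, a⟩
    obtain ⟨x, rfl⟩ := grMk_surjective _ a
    exact graded_ext (zero_add i) (one_mul _)
  mul_one := by
    rintro ⟨i, a⟩
    obtain ⟨x, rfl⟩ := grMk_surjective _ a
    exact graded_ext (add_zero i) (mul_one _)
  mul_assoc := by
    rintro ⟨i, a⟩ ⟨j, b⟩ ⟨l, c⟩
    obtain ⟨x, rfl⟩ := grMk_surjective _ a
    obtain ⟨y, rfl⟩ := grMk_surjective _ b
    obtain ⟨z, rfl⟩ := grMk_surjective _ c
    exact graded_ext (add_assoc i j l) (mul_assoc _ _ _)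
  natCast n := n • grMk k A 0 ⟨1, one_mem_corad⟩
  natCast_zero := zero_smul _ _
  natCast_succ n := succ_nsmul _ n
  intCast n := n • grMk k A 0 ⟨1, one_mem_corad⟩
  intCast_ofNat n := natCast_zsmul _ n
  intCast_negSucc_ofNat n := negSucc_zsmul _ n

instance instGAlgebraGr : DirectSum.GAlgebra k (GrComp k A) where
  toFun := (LinearMap.toSpanSingleton k _ (grMk k A 0 ⟨1, one_mem_corad⟩)).toAddMonoidHom
  map_one := one_smul k (grMk k A 0 ⟨1, one_mem_corad⟩)
  map_mul r s := by
    refine graded_ext (i := 0) (j := 0 + 0) (x := (r * s) • ⟨1, one_mem_corad⟩)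
      (y := ⟨(r • (1 : A)) * (s • (1 : A)), mul_mem_corad (Submodule.smul_mem _ _ one_mem_corad)
        (Submodule.smul_mem _ _ one_mem_corad)⟩) rfl ?_
    simp [mul_smul, smul_comm r s]
  commutes r := by
    rintro ⟨i, a⟩
    obtain ⟨x, rfl⟩ := grMk_surjective _ a
    refine graded_ext (i := 0 + i) (j := i + 0)
      (x := ⟨(r • (1 : A)) * x, mul_mem_corad (Submodule.smul_mem _ _ one_mem_corad) x.2⟩)
      (y := ⟨x * (r • (1 : A)), mul_mem_corad x.2 (Submodule.smul_mem _ _ one_mem_corad)⟩)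
      (by ring) (by simp)
  smul_def r := by
    rintro ⟨i, a⟩
    obtain ⟨x, rfl⟩ := grMk_surjective _ a
    refine graded_ext (i := i) (j := 0 + i) (x := r • x)
      (y := ⟨(r • (1 : A)) * x, mul_mem_corad (Submodule.smul_mem _ _ one_mem_corad) x.2⟩)
      (by ring) (by simp)

lemma symb_mul {i j : ℕ} {x y : A} (hx : x ∈ corad k A i) (hy : y ∈ corad k A j) :
    symb k A (i + j) (x * y) = symb k A i x * symb k A j y := by
  have h1 := symb_apply (⟨x, hx⟩ : corad k A i)
  have h2 := symb_apply (⟨y, hy⟩ : corad k A j)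
  have h3 := symb_apply (⟨x * y, mul_mem_corad hx hy⟩ : corad k A (i + j))
  simp only [DirectSum.lof_eq_of] at h1 h2 h3
  rw [h1, h2, h3, DirectSum.of_mul_of]
  rfl

lemma symb_one : symb k A 0 (1 : A) = 1 := by
  have h1 := symb_apply (⟨1, one_mem_corad⟩ : corad k A 0)
  simp only [DirectSum.lof_eq_of] at h1
  exact h1

lemma symb₂_mul {m n : ℕ} {x y : A} (hx : x ∈ corad k A m) (hy : y ∈ corad k A n) :
    symb₂ k A (m + n) (Coalgebra.comul x * Coalgebra.comul y) =
      symb₂ k A m (Coalgebra.comul x) * symb₂ k A n (Coalgebra.comul y) := by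
  refine comul_ext (symb₂ k A (m + n) ∘ₗ LinearMap.mulRight k (Coalgebra.comul (R := k) y))
    (LinearMap.mulRight k (symb₂ k A n (Coalgebra.comul y)) ∘ₗ symb₂ k A m) ?_ hx
  intro i j hij u hu v hv
  refine comul_ext (symb₂ k A (m + n) ∘ₗ LinearMap.mulLeft k (u ⊗ₜ[k] v))
    (LinearMap.mulLeft k (symb₂ k A m (u ⊗ₜ[k] v)) ∘ₗ symb₂ k A n) ?_ hy
  intro i' j' hij' u' hu' v' hv'
  subst hij hij'
  simp only [LinearMap.comp_apply, LinearMap.mulLeft_apply]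
  rw [Algebra.TensorProduct.tmul_mul_tmul, symb₂_tmul hu hv, symb₂_tmul hu' hv',
    Algebra.TensorProduct.tmul_mul_tmul, ← symb_mul hu hu', ← symb_mul hv hv',
    ← symb₂_tmul (mul_mem_corad hu hu') (mul_mem_corad hv hv'), add_add_add_comm]

lemma grComul_mul (a b : Gr k A) : grComul k A (a * b) = grComul k A a * grComul k A b := by
  induction a using gr_induction with
  | h0 => simp
  | hadd a a' ha ha' => rw [add_mul, map_add, map_add, ha, ha', add_mul]
  | h m x hx =>
    induction b using gr_induction with
    | h0 => simp
    | hadd a a' ha ha' => rw [mul_add, map_add, map_add, ha, ha', mul_add]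
    | h n y hy =>
      rw [← symb_mul hx hy, grComul_symb (mul_mem_corad hx hy), grComul_symb hx, grComul_symb hy,
        Bialgebra.comul_mul, symb₂_mul hx hy]

lemma grCounit_mul (a b : Gr k A) : grCounit k A (a * b) = grCounit k A a * grCounit k A b := by
  induction a using gr_induction with
  | h0 => simp
  | hadd a a' ha ha' => rw [add_mul, map_add, map_add, ha, ha', add_mul]
  | h m x hx =>
    induction b using gr_induction with
    | h0 => simp
    | hadd a a' ha ha' => rw [mul_add, map_add, map_add, ha, ha', mul_add]
    | h n y hy =>
      rw [← symb_mul hx hy]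
      rcases Nat.eq_zero_or_pos m with rfl | hm
      · rcases Nat.eq_zero_or_pos n with rfl | hn
        · rw [grCounit_symb_zero hx, grCounit_symb_zero hy,
            grCounit_symb_zero (mul_mem_corad hx hy), Bialgebra.counit_mul]
        · rw [grCounit_symb hn.ne' hy, grCounit_symb (by omega) (mul_mem_corad hx hy), mul_zero]
      · rw [grCounit_symb hm.ne' hx, grCounit_symb (by omega) (mul_mem_corad hx hy), zero_mul]

lemma grComul_one : grComul k A 1 = 1 := by
  rw [← symb_one, grComul_symb one_mem_corad, Bialgebra.comul_one,
    Algebra.TensorProduct.one_def, symb₂_tmul (i := 0) (j := 0) one_mem_corad one_mem_corad,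
    symb_one, Algebra.TensorProduct.one_def]

lemma grCounit_one : grCounit k A 1 = 1 := by
  rw [← symb_one, grCounit_symb_zero one_mem_corad, Bialgebra.counit_one]

noncomputable instance instBialgebraGr : Bialgebra k (Gr k A) :=
  Bialgebra.mk' k (Gr k A) (C := instCoalgebraGr) grCounit_one
    (fun {a b} => grCounit_mul a b) grComul_one (fun {a b} => grComul_mul a b)

end Bialg

section Hopf

variable {k : Type u} {H : Type v} [Field k] [Ring H] [HopfAlgebra k H] [IsConnectedCoalgebra k H]

lemma antipode_mem_corad {n : ℕ} {x : H} (hx : x ∈ corad k H n) :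
    HopfAlgebra.antipode k x ∈ corad k H n := by
  induction n using Nat.strong_induction_on generalizing x with
  | _ n ih =>
  rcases n with _ | n
  · obtain ⟨c, rfl⟩ := exists_smul_one hx
    rw [map_smul, HopfAlgebra.antipode_one]
    exact hx
  -- `Δ(x) = 1 ⊗ y + w` with `w` in the sum of the `Cᵢ ⊗ Cⱼ`, `j < n + 1`
  let T : Submodule k (H ⊗[k] H) :=
    (corad k H n).comap ((TensorProduct.lid k H).toLinearMap ∘ₗ Coalgebra.counit.rTensor H) ⊓
    (corad k H (n + 1)).comap
      (LinearMap.mul' k H ∘ₗ (HopfAlgebra.antipode k).lTensor H)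
  let f : H →ₗ[k] H ⊗[k] H := TensorProduct.mk k H H 1
  have h : Coalgebra.comul (R := k) x ∈ (corad k H (n + 1)).map f ⊔ T := by
    refine comul_mem_of ?_ hx
    intro i j hij u hu v hv
    rcases i with _ | i
    · obtain ⟨c, rfl⟩ := exists_smul_one hu
      rw [← TensorProduct.smul_tmul']
      refine Submodule.smul_mem _ _ (Submodule.mem_sup_left ⟨v, ?_, rfl⟩)
      rw [zero_add] at hij
      subst hij
      exact hv
    · refine Submodule.mem_sup_right ⟨?_, ?_⟩
      · change Coalgebra.counit (R := k) u • v ∈ corad k H n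
        exact Submodule.smul_mem _ _ (corad_mono (by omega) hv)
      · change u * HopfAlgebra.antipode k v ∈ corad k H (n + 1)
        rw [← hij]
        exact mul_mem_corad hu (ih j (by omega) hv)
  obtain ⟨-, ⟨y, hy, rfl⟩, w, ⟨hw1, hw2⟩, hxy⟩ := Submodule.mem_sup.1 h
  have e1 := congrArg ((TensorProduct.lid k H).toLinearMap ∘ₗ Coalgebra.counit.rTensor H) hxy
  have e2 := congrArg (LinearMap.mul' k H ∘ₗ (HopfAlgebra.antipode k).lTensor H) hxy
  rw [map_add] at e1 e2
  simp only [f, LinearMap.comp_apply, Coalgebra.rTensor_counit_comul,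
    HopfAlgebra.mul_antipode_lTensor_comul_apply, TensorProduct.mk_apply,
    LinearMap.rTensor_tmul, LinearMap.lTensor_tmul, LinearMap.mul'_apply,
    Bialgebra.counit_one, one_mul, LinearEquiv.coe_coe, TensorProduct.lid_tmul, one_smul] at e1 e2
  have hy' : HopfAlgebra.antipode k y ∈ corad k H (n + 1) := by
    rw [eq_sub_of_add_eq e2]
    refine sub_mem ?_ hw2
    rw [Algebra.algebraMap_eq_smul_one]
    exact Submodule.smul_mem _ _ (corad_mono (Nat.zero_le _) one_mem_corad)
  rw [← e1, map_add]
  exact add_mem hy' (corad_mono (Nat.le_succ n) (ih n (Nat.lt_succ_self n) hw1))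

lemma antipode_mem_coradPred {n : ℕ} {x : H} (hx : x ∈ coradPred k H n) :
    HopfAlgebra.antipode k x ∈ coradPred k H n := by
  rcases n with _ | n
  · rw [(Submodule.mem_bot k).1 hx, map_zero]
    exact zero_mem _
  · exact antipode_mem_corad hx

variable (k H) in
/-- The antipode of `gr H`, induced by the antipode of `H`. -/
noncomputable def grAntipode : Gr k H →ₗ[k] Gr k H :=
  DirectSum.toModule k ℕ _ fun n =>
    grLift k H n (symb k H n ∘ₗ HopfAlgebra.antipode k ∘ₗ (corad k H n).subtype)
      (fun _ hx => symb_eq_zero_of_mem (antipode_mem_coradPred hx))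

lemma grAntipode_symb {n : ℕ} {x : H} (hx : x ∈ corad k H n) :
    grAntipode k H (symb k H n x) = symb k H n (HopfAlgebra.antipode k x) := by
  have h := symb_apply (⟨x, hx⟩ : corad k H n)
  simp only at h
  rw [h, grAntipode, DirectSum.toModule_lof, grLift_grMk]
  rfl

lemma symb_counit {n : ℕ} {x : H} (hx : x ∈ corad k H n) :
    symb k H n (algebraMap k H (Coalgebra.counit x)) =
      algebraMap k (Gr k H) (grCounit k H (symb k H n x)) := by
  rw [Algebra.algebraMap_eq_smul_one, Algebra.algebraMap_eq_smul_one, map_smul]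
  rcases n with _ | n
  · rw [symb_one, grCounit_symb_zero hx]
  · rw [grCounit_symb (Nat.succ_ne_zero n) hx, symb_eq_zero (Nat.succ_pos n) one_mem_corad,
      smul_zero, zero_smul]

/-- The associated graded Hopf algebra of a connected Hopf algebra. -/
noncomputable instance instHopfAlgebraGr : HopfAlgebra k (Gr k H) where
  antipode := grAntipode k H
  mul_antipode_rTensor_comul := by
    refine gr_ext fun n x hx => ?_
    change LinearMap.mul' k (Gr k H) ((grAntipode k H).rTensor _ (grComul k H (symb k H n x))) =
      algebraMap k (Gr k H) (grCounit k H (symb k H n x))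
    rw [grComul_symb hx, ← symb_counit hx, ← HopfAlgebra.mul_antipode_rTensor_comul_apply]
    refine comul_ext (LinearMap.mul' k (Gr k H) ∘ₗ (grAntipode k H).rTensor _ ∘ₗ symb₂ k H n)
      (symb k H n ∘ₗ LinearMap.mul' k H ∘ₗ (HopfAlgebra.antipode k).rTensor H) ?_ hx
    rintro i j rfl u hu v hv
    simp only [LinearMap.comp_apply]
    rw [symb₂_tmul hu hv, LinearMap.rTensor_tmul, LinearMap.rTensor_tmul, LinearMap.mul'_apply,
      LinearMap.mul'_apply, grAntipode_symb hu, symb_mul (antipode_mem_corad hu) hv]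
  mul_antipode_lTensor_comul := by
    refine gr_ext fun n x hx => ?_
    change LinearMap.mul' k (Gr k H) ((grAntipode k H).lTensor _ (grComul k H (symb k H n x))) =
      algebraMap k (Gr k H) (grCounit k H (symb k H n x))
    rw [grComul_symb hx, ← symb_counit hx, ← HopfAlgebra.mul_antipode_lTensor_comul_apply]
    refine comul_ext (LinearMap.mul' k (Gr k H) ∘ₗ (grAntipode k H).lTensor _ ∘ₗ symb₂ k H n)
      (symb k H n ∘ₗ LinearMap.mul' k H ∘ₗ (HopfAlgebra.antipode k).lTensor H) ?_ hx
    rintro i j rfl u hu v hv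
    simp only [LinearMap.comp_apply]
    rw [symb₂_tmul hu hv, LinearMap.lTensor_tmul, LinearMap.lTensor_tmul, LinearMap.mul'_apply,
      LinearMap.mul'_apply, grAntipode_symb hv, symb_mul hu (antipode_mem_corad hv)]

end Hopf

section Graded

variable {k : Type u} {H : Type v} [Field k] [Ring H] [HopfAlgebra k H]

/-- A grading `H = ⨁ₙ H(n)` of a Hopf algebra that makes it a graded Hopf algebra. -/
structure IsGradedHopfAlgebra (G : ℕ → Submodule k H) : Prop where
  isInternal : DirectSum.IsInternal G
  one_mem : (1 : H) ∈ G 0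
  mul_mem : ∀ {i j : ℕ} {x y : H}, x ∈ G i → y ∈ G j → x * y ∈ G (i + j)
  comul_mem : ∀ {n : ℕ} {x : H}, x ∈ G n →
    Coalgebra.comul (R := k) x ∈ ⨆ i : ℕ, ⨆ j : ℕ, ⨆ _ : i + j = n, tensorSub (G i) (G j)
  counit_eq_zero : ∀ {n : ℕ} {x : H}, n ≠ 0 → x ∈ G n → Coalgebra.counit (R := k) x = 0
  antipode_mem : ∀ {n : ℕ} {x : H}, x ∈ G n → HopfAlgebra.antipode k x ∈ G n

/-- A graded Hopf algebra `H = ⨁ₙ H(n)` that is coradically graded: the coradical filtration is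
`Hₙ = H(0) ⊕ ⋯ ⊕ H(n)`. -/
structure IsCoradicallyGradedHopfAlgebra (G : ℕ → Submodule k H) : Prop
    extends IsGradedHopfAlgebra G where
  corad_eq : ∀ n : ℕ, corad k H n = ⨆ m : ℕ, ⨆ _ : m ≤ n, G m

end Graded

/-- The truncated polynomial algebra `k[x₁, …, x_d] / (x₁ᵖ, …, x_dᵖ)`. -/
abbrev TruncPoly (k : Type u) [Field k] (p d : ℕ) : Type u :=
  MvPolynomial (Fin d) k ⧸
    Ideal.span (Set.range fun i : Fin d => (MvPolynomial.X i : MvPolynomial (Fin d) k) ^ p)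

end ConnHopf

/-!
Both parts concern a graded connected bialgebra `A` (`A` is `H`, or `gr H`) whose primitive elements
live in degree at most `1`; this is `IsStrictlyGraded`. For a coradically graded `H` the condition
on primitives holds because a primitive element lies in `H₁ = H(0) ⊕ H(1)`. For `gr H` it holds
because a class in degree `n ≥ 2` whose comultiplication has no component of bidegree `(1, n - 1)`
is represented by an element of `H₀ ∧ Hₙ₋₂ = Hₙ₋₁` (`symb_eq_zero_of_primitive`).

For `x` homogeneous of degree `n > 0`, `Δ(x) = x ⊗ 1 + 1 ⊗ x + w` with `w` a sum of tensors of
elements of degrees strictly between `0` and `n`. Hence, by induction on the degree, commutators of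
homogeneous elements of positive degree are primitive of degree at least `2`, so they vanish and `A`
is commutative (`IsStrictlyGraded.mul_comm`). Then `p`-th powers are additive, and by the same
induction the `p`-th power of a homogeneous element of positive degree is primitive of degree at
least `2`, hence zero (`IsStrictlyGraded.pow_eq_zero`).

It remains to treat a finite-dimensional commutative bialgebra in which `a ^ p = 0` for all `a` in
the augmentation ideal `M` (`nonempty_algEquiv_truncPoly`). Let `x₁, …, x_d` lift a basis of
`M / M²`. They generate the algebra, as `M` is nilpotent. The dual tangent vectors extend to
invariant derivations, and inverting the matrix of their values at the `xⱼ` gives derivations with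
`Dᵢ(xⱼ) = δᵢⱼ` (`exists_dual_derivations`). So the kernel of `k[X₁, …, X_d] → A` is stable under the
partial derivatives. As it contains no polynomial with nonzero constant term, its elements have no
monomials with all exponents below `p`, and it equals `(X₁ᵖ, …, X_dᵖ)`.
-/

namespace ConnHopf

open scoped TensorProduct DirectSum

universe u v

/-! ### Commutative bialgebras whose augmentation ideal is killed by `p`-th powers -/

section Commutative

variable {k : Type u} {A : Type v} [Field k] [CommRing A]

/-- Over `k` of characteristic `p`, the coefficient at `b` of a polynomial is, up to the unit `b!`,
the constant term of a higher derivative as long as all entries of `b` are below `p`. So these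
coefficients vanish on a space of polynomials without constant term stable under the partial
derivatives. -/
lemma coeff_eq_zero_of_pderiv_mem {p : ℕ} [CharP k p] {σ : Type*} [DecidableEq σ]
    {K : Submodule k (MvPolynomial σ k)}
    (h0 : ∀ f ∈ K, MvPolynomial.constantCoeff f = 0)
    (hK : ∀ i, ∀ f ∈ K, MvPolynomial.pderiv i f ∈ K)
    (b : σ →₀ ℕ) (hb : ∀ i, b i < p) {f : MvPolynomial σ k} (hf : f ∈ K) :
    MvPolynomial.coeff b f = 0 := by
  induction hn : b.degree generalizing b f with
  | zero =>
    rw [Finsupp.degree_eq_zero_iff] at hn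
    subst hn
    exact h0 f hf
  | succ n ih =>
    obtain ⟨i, hi⟩ : ∃ i, b i ≠ 0 := by
      by_contra! h
      have : b = 0 := Finsupp.ext h
      simp [this] at hn
    have hle : Finsupp.single i 1 ≤ b := by
      rw [Finsupp.single_le_iff]
      exact Nat.one_le_iff_ne_zero.2 hi
    obtain ⟨c, rfl⟩ : ∃ c, b = c + Finsupp.single i 1 := ⟨b - Finsupp.single i 1,
      (tsub_add_cancel_of_le hle).symm⟩
    have h1 := ih c (fun j => lt_of_le_of_lt (by simp) (hb j)) (hK i f hf)
      (by simpa using hn)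
    rw [MvPolynomial.coeff_pderiv] at h1
    refine (mul_eq_zero.1 h1).resolve_right ?_
    have h2 := hb i
    simp only [Finsupp.add_apply, Finsupp.single_eq_same] at h2
    have h3 : ((c i + 1 : ℕ) : k) ≠ 0 := fun h =>
      Nat.not_dvd_of_pos_of_lt (Nat.succ_pos _) h2 ((CharP.cast_eq_zero_iff k p _).1 h)
    simpa using h3

lemma mem_span_X_pow {p : ℕ} {σ : Type*} {f : MvPolynomial σ k}
    (h : ∀ b : σ →₀ ℕ, (∀ i, b i < p) → MvPolynomial.coeff b f = 0) :
    f ∈ Ideal.span (Set.range fun i : σ => (MvPolynomial.X i : MvPolynomial σ k) ^ p) := by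
  rw [f.as_sum]
  refine Ideal.sum_mem _ fun b hb => ?_
  obtain ⟨i, hi⟩ : ∃ i, p ≤ b i := by
    by_contra! hlt
    exact MvPolynomial.mem_support_iff.1 hb (h b hlt)
  have hle : Finsupp.single i p ≤ b := Finsupp.single_le_iff.2 hi
  have : MvPolynomial.monomial b (MvPolynomial.coeff b f) =
      MvPolynomial.monomial (b - Finsupp.single i p) (MvPolynomial.coeff b f) *
        MvPolynomial.X i ^ p := by
    rw [MvPolynomial.X_pow_eq_monomial, MvPolynomial.monomial_mul, mul_one,
      tsub_add_cancel_of_le hle]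
  rw [this]
  exact Ideal.mul_mem_left _ _ (Ideal.subset_span ⟨i, rfl⟩)

lemma derivation_aeval [Algebra k A] {σ : Type*} [DecidableEq σ] (x : σ → A)
    (D : Derivation k A A) (i : σ)
    (hD : ∀ j, D (x j) = if i = j then 1 else 0) (f : MvPolynomial σ k) :
    D (MvPolynomial.aeval x f) = MvPolynomial.aeval x (MvPolynomial.pderiv i f) := by
  induction f using MvPolynomial.induction_on with
  | C a => simp
  | add f g hf hg => simp [hf, hg]
  | mul_X f j hf =>
    rw [map_mul, Derivation.leibniz, Derivation.leibniz, MvPolynomial.aeval_X, hD,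
      MvPolynomial.pderiv_X, hf]
    by_cases h : i = j
    · subst h; simp
    · simp [h, Ne.symm h]

variable [Bialgebra k A]

/-- A functional `f` with `f(ab) = ε(a)f(b) + ε(b)f(a)` (a tangent vector at the counit) extends
to the left invariant derivation `(id ⊗ f) ∘ Δ`. -/
noncomputable def invariantDerivation (f : A →ₗ[k] k)
    (hf : ∀ a b, f (a * b) = Coalgebra.counit (R := k) a * f b + Coalgebra.counit (R := k) b * f a) :
    Derivation k A A :=
  Derivation.mk' ((TensorProduct.rid k A).toLinearMap ∘ₗ f.lTensor A ∘ₗ Coalgebra.comul) (by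
    intro a b
    let F : A ⊗[k] A →ₗ[k] A := (TensorProduct.rid k A).toLinearMap ∘ₗ f.lTensor A
    let E : A ⊗[k] A →ₗ[k] A := (TensorProduct.rid k A).toLinearMap ∘ₗ
      (Coalgebra.counit (R := k)).lTensor A
    have hE (c : A) : E (Coalgebra.comul c) = c := by
      simp [E, Coalgebra.lTensor_counit_comul]
    have h (s t : A ⊗[k] A) : F (s * t) = E s * F t + E t * F s := by
      induction s using TensorProduct.induction_on with
      | zero => simp
      | add s s' hs hs' => rw [add_mul, map_add, map_add, map_add, hs, hs']; ring
      | tmul u v =>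
        induction t using TensorProduct.induction_on with
        | zero => simp
        | add s s' hs hs' => rw [mul_add, map_add, map_add, map_add, hs, hs']; ring
        | tmul u' v' =>
          simp only [F, E, Algebra.TensorProduct.tmul_mul_tmul, LinearMap.comp_apply,
            LinearMap.lTensor_tmul, hf, LinearEquiv.coe_coe, TensorProduct.rid_tmul, add_smul,
            smul_mul_assoc, mul_smul_comm, mul_smul, mul_comm u' u]
          simp only [smul_smul, mul_comm]
    have h' := h (Coalgebra.comul a) (Coalgebra.comul b)
    rw [← Bialgebra.comul_mul, hE, hE] at h'
    exact h')

lemma counit_invariantDerivation (f : A →ₗ[k] k)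
    (hf : ∀ a b, f (a * b) = Coalgebra.counit (R := k) a * f b + Coalgebra.counit (R := k) b * f a)
    (a : A) : Coalgebra.counit (R := k) (invariantDerivation f hf a) = f a := by
  have h (t : A ⊗[k] A) : Coalgebra.counit (R := k) (TensorProduct.rid k A (f.lTensor A t)) =
      f (TensorProduct.lid k A ((Coalgebra.counit (R := k)).rTensor A t)) := by
    induction t using TensorProduct.induction_on with
    | zero => simp
    | add s s' hs hs' => simp only [map_add, hs, hs']
    | tmul u v => simp [mul_comm]
  change Coalgebra.counit (R := k) (TensorProduct.rid k A (f.lTensor A (Coalgebra.comul a))) = _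
  rw [h, Coalgebra.rTensor_counit_comul, TensorProduct.lid_tmul, one_smul]

/-- The tangent vectors `f i` dual to the `x i` modulo the augmentation ideal are turned into
derivations `D i` of `A` with `D i (x j) = δ i j` exactly: the matrix of the values of the invariant
derivations reduces to the identity modulo a nil ideal, hence is invertible. -/
lemma exists_dual_derivations {ι : Type*} [Fintype ι] [DecidableEq ι]
    (hnil : ∀ a : A, Coalgebra.counit (R := k) a = 0 → IsNilpotent a)
    (x : ι → A) (f : ι → A →ₗ[k] k)
    (hf : ∀ i a b, f i (a * b) =
      Coalgebra.counit (R := k) a * f i b + Coalgebra.counit (R := k) b * f i a)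
    (hfx : ∀ i j, f i (x j) = if i = j then 1 else 0) :
    ∃ D : ι → Derivation k A A, ∀ i j, D i (x j) = if i = j then 1 else 0 := by
  let M : Matrix ι ι A := Matrix.of fun i j => invariantDerivation (f i) (hf i) (x j)
  have hM : (Bialgebra.counitAlgHom k A : A →+* k).mapMatrix M = 1 := by
    ext i j
    rw [Matrix.one_apply, ← hfx i j]
    exact counit_invariantDerivation (f i) (hf i) (x j)
  have hdet : IsUnit M.det := by
    have h1 : (Bialgebra.counitAlgHom k A : A →+* k) M.det = 1 := by
      rw [RingHom.map_det, hM, Matrix.det_one]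
    have h2 : IsNilpotent (M.det - 1) := hnil _ (by
      rw [map_sub, Bialgebra.counit_one, sub_eq_zero]; exact h1)
    simpa using h2.isUnit_one_add
  refine ⟨fun i => ∑ l, M⁻¹ i l • invariantDerivation (f l) (hf l), fun i j => ?_⟩
  have h := congrFun (congrFun (Matrix.nonsing_inv_mul M hdet) i) j
  rw [Matrix.mul_apply, Matrix.one_apply] at h
  rw [← h]
  exact (congrFun (map_sum (Derivation.coeFnAddMonoidHom (R := k) (A := A) (M := A))
    (fun l => M⁻¹ i l • invariantDerivation (f l) (hf l)) Finset.univ) (x j)).trans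
    (Finset.sum_apply _ _ _)

variable (k A) in
/-- The augmentation ideal, as a subspace. -/
abbrev augmentation : Submodule k A := LinearMap.ker (Coalgebra.counit (R := k) (A := A))

lemma sub_smul_one_mem_augmentation (a : A) :
    a - Coalgebra.counit (R := k) a • (1 : A) ∈ augmentation k A := by
  simp

/-- Lifts of a basis of the cotangent space at the counit, and the dual tangent vectors. -/
lemma exists_cotangent_basis [FiniteDimensional k A] :
    ∃ (d : ℕ) (x : Fin d → A) (f : Fin d → A →ₗ[k] k),
      (∀ i, x i ∈ augmentation k A) ∧
      augmentation k A ≤ Submodule.span k (Set.range x) ⊔ augmentation k A * augmentation k A ∧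
      (∀ i a b, f i (a * b) =
        Coalgebra.counit (R := k) a * f i b + Coalgebra.counit (R := k) b * f i a) ∧
      ∀ i j, f i (x j) = if i = j then 1 else 0 := by
  let M := augmentation k A
  let M2 : Submodule k M := (M * M).submoduleOf M
  let b := Module.finBasis k (M ⧸ M2)
  choose y hy using fun i => M2.mkQ_surjective (b i)
  let π : A →ₗ[k] M := (LinearMap.id - (Coalgebra.counit (R := k)).smulRight (1 : A)).codRestrict M
    fun a => sub_smul_one_mem_augmentation a
  have hπ (a : A) : (π a : A) = a - Coalgebra.counit (R := k) a • (1 : A) := rfl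
  refine ⟨_, fun i => y i, fun i => b.coord i ∘ₗ M2.mkQ ∘ₗ π, fun i => (y i).2, ?_, ?_, ?_⟩
  · intro a ha
    let c := b.repr (M2.mkQ ⟨a, ha⟩)
    have h : (⟨a, ha⟩ - ∑ i, c i • y i : M) ∈ M2 := by
      refine (Submodule.Quotient.mk_eq_zero M2).1 ?_
      change M2.mkQ (⟨a, ha⟩ - ∑ i, c i • y i) = 0
      rw [map_sub, map_sum]
      simp only [map_smul, hy]
      rw [b.sum_repr, sub_self]
    have h' : a - ∑ i, c i • (y i : A) ∈ M * M := by
      simpa [M2, Submodule.submoduleOf] using h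
    rw [← add_sub_cancel (∑ i, c i • (y i : A)) a]
    refine add_mem (Submodule.mem_sup_left (Submodule.sum_mem _ fun i _ =>
      Submodule.smul_mem _ _ (Submodule.subset_span ⟨i, rfl⟩))) (Submodule.mem_sup_right h')
  · intro i a c
    have h : π (a * c) - (Coalgebra.counit (R := k) a • π c + Coalgebra.counit (R := k) c • π a)
        ∈ M2 := by
      change (π (a * c) : A) - (Coalgebra.counit (R := k) a • (π c : A) +
        Coalgebra.counit (R := k) c • (π a : A)) ∈ M * M
      have e : (π (a * c) : A) - (Coalgebra.counit (R := k) a • (π c : A) +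
          Coalgebra.counit (R := k) c • (π a : A)) = (π a : A) * π c := by
        simp only [hπ, Bialgebra.counit_mul, Algebra.smul_def, map_mul, mul_one]
        ring
      rw [e]
      exact Submodule.mul_mem_mul (π a).2 (π c).2
    rw [← M2.ker_mkQ, LinearMap.mem_ker, map_sub, sub_eq_zero] at h
    simp only [LinearMap.comp_apply]
    rw [h]
    simp
  · intro i j
    have h : π (y j) = y j := by
      apply Subtype.ext
      rw [hπ, LinearMap.mem_ker.1 (y j).2, zero_smul, sub_zero]
    simp only [LinearMap.comp_apply, h, hy, Module.Basis.coord_apply, Module.Basis.repr_self]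
    rw [Finsupp.single_apply]
    simp [eq_comm]

/-- If `X` spans the augmentation ideal `M` modulo `M ^ 2`, then `X ^ n` spans `M ^ n` modulo
`M ^ (n + 1)`. -/
lemma augmentation_pow_le {X : Submodule k A} (hX : X ≤ augmentation k A)
    (h : augmentation k A ≤ X ⊔ augmentation k A * augmentation k A) (n : ℕ) :
    augmentation k A ^ n ≤ X ^ n ⊔ augmentation k A ^ (n + 1) := by
  set M := augmentation k A
  induction n with
  | zero => rw [pow_zero, pow_zero]; exact le_sup_left
  | succ n ih =>
    have hXn : X ^ n ≤ M ^ n := pow_le_pow_left' hX n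
    calc M ^ (n + 1) = M ^ n * M := pow_succ _ _
      _ ≤ (X ^ n ⊔ M ^ (n + 1)) * (X ⊔ M * M) := mul_le_mul' ih h
      _ ≤ X ^ (n + 1) ⊔ M ^ (n + 1 + 1) := by
        rw [Submodule.sup_mul, Submodule.mul_sup, Submodule.mul_sup]
        refine sup_le (sup_le ?_ ?_) (sup_le ?_ ?_)
        · exact le_sup_of_le_left (pow_succ _ _).ge
        · refine le_sup_of_le_right ((mul_le_mul_left hXn _).trans ?_)
          rw [← pow_two, ← pow_add]
        · exact le_sup_of_le_right ((mul_le_mul_right hX _).trans (pow_succ _ _).ge)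
        · refine le_sup_of_le_right ?_
          rw [pow_succ M (n + 1)]
          refine mul_le_mul' le_rfl (Submodule.mul_le.2 fun a ha b _ => ?_)
          rw [LinearMap.mem_ker, Bialgebra.counit_mul, LinearMap.mem_ker.1 ha, zero_mul]

lemma augmentation_pow_eq_bot [FiniteDimensional k A]
    (hnil : ∀ a : A, Coalgebra.counit (R := k) a = 0 → IsNilpotent a) :
    ∃ n, augmentation k A ^ n = ⊥ := by
  let m : Ideal A := RingHom.ker (Bialgebra.counitAlgHom k A)
  have : IsNoetherianRing A := IsNoetherianRing.of_finite k A
  have hm : IsNilpotent m := (Ideal.FG.isNilpotent_iff_le_nilradical (IsNoetherian.noetherian m)).2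
    fun a ha => hnil a ha
  obtain ⟨n, hn⟩ := hm
  have h (n : ℕ) : augmentation k A ^ n ≤ (m ^ n).restrictScalars k := by
    induction n with
    | zero => rw [pow_zero, pow_zero, Ideal.one_eq_top]; exact le_top
    | succ n ih =>
      rw [pow_succ, pow_succ]
      exact Submodule.mul_le.2 fun a ha b hb => Ideal.mul_mem_mul (ih ha) hb
  refine ⟨n, eq_bot_iff.2 fun a ha => ?_⟩
  have := h n ha
  rw [hn] at this
  exact this

/-- Since the augmentation ideal is nilpotent, a subset of it that spans it modulo its square
generates the algebra. -/
lemma adjoin_eq_top_of_augmentation_le [FiniteDimensional k A]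
    (hnil : ∀ a : A, Coalgebra.counit (R := k) a = 0 → IsNilpotent a)
    {s : Set A} (hs : s ⊆ augmentation k A)
    (h : augmentation k A ≤ Submodule.span k s ⊔ augmentation k A * augmentation k A) :
    Algebra.adjoin k s = ⊤ := by
  set S := Algebra.adjoin k s
  have hX (n : ℕ) : Submodule.span k s ^ n ≤ Subalgebra.toSubmodule S := by
    induction n with
    | zero => rw [pow_zero]; exact Submodule.one_le.2 (one_mem S)
    | succ n ih =>
      rw [pow_succ]
      exact Submodule.mul_le.2 fun a ha b hb => S.mul_mem (ih ha)
        (Submodule.span_le (p := Subalgebra.toSubmodule S).2 Algebra.subset_adjoin hb)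
  have hS (n : ℕ) : (⊤ : Submodule k A) ≤
      Subalgebra.toSubmodule S ⊔ augmentation k A ^ (n + 1) := by
    induction n with
    | zero =>
      intro a _
      rw [← add_sub_cancel (Coalgebra.counit (R := k) a • (1 : A)) a, zero_add, pow_one]
      exact add_mem (Submodule.mem_sup_left (S.smul_mem (one_mem S) _))
        (Submodule.mem_sup_right (sub_smul_one_mem_augmentation a))
    | succ n ih =>
      refine ih.trans (sup_le le_sup_left ?_)
      exact (augmentation_pow_le (Submodule.span_le.2 hs) h (n + 1)).trans
        (sup_le_sup_right (hX (n + 1)) _)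
  obtain ⟨n, hn⟩ := augmentation_pow_eq_bot hnil
  rw [← Algebra.toSubmodule_eq_top, eq_top_iff]
  simpa [pow_succ, hn] using hS n

/-- A finite-dimensional commutative bialgebra in characteristic `p` in which the elements of the
augmentation ideal have zero `p`-th power is a truncated polynomial algebra. -/
theorem nonempty_algEquiv_truncPoly [FiniteDimensional k A] (p : ℕ) [Fact p.Prime] [CharP k p]
    (h : ∀ a : A, Coalgebra.counit (R := k) a = 0 → a ^ p = 0) :
    ∃ d : ℕ, Nonempty (A ≃ₐ[k] TruncPoly k p d) := by
  have hnil (a : A) (ha : Coalgebra.counit (R := k) a = 0) : IsNilpotent a := ⟨p, h a ha⟩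
  obtain ⟨d, x, f, hx, hgen, hf, hfx⟩ := exists_cotangent_basis (k := k) (A := A)
  obtain ⟨D, hD⟩ := exists_dual_derivations hnil x f hf hfx
  let φ : MvPolynomial (Fin d) k →ₐ[k] A := MvPolynomial.aeval x
  have hφ : Function.Surjective φ := by
    rw [← AlgHom.range_eq_top, ← Algebra.adjoin_range_eq_range_aeval]
    exact adjoin_eq_top_of_augmentation_le hnil (by rintro _ ⟨i, rfl⟩; exact hx i) hgen
  have hker : Ideal.span (Set.range fun i : Fin d => (MvPolynomial.X i : MvPolynomial (Fin d) k) ^ p)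
      = RingHom.ker φ := by
    refine le_antisymm (Ideal.span_le.2 ?_) fun g hg => mem_span_X_pow fun b hb => ?_
    · rintro _ ⟨i, rfl⟩
      simp [φ, h _ (hx i)]
    · refine coeff_eq_zero_of_pderiv_mem (K := LinearMap.ker φ.toLinearMap) ?_ ?_ b hb hg
      · intro g hg
        have hg' : φ g = 0 := hg
        have e : (Bialgebra.counitAlgHom k A).comp φ = MvPolynomial.aeval 0 :=
          MvPolynomial.algHom_ext fun i => by
            simpa [φ] using hx i
        have := congrArg (Bialgebra.counitAlgHom k A) hg'
        rw [map_zero, ← AlgHom.comp_apply, e] at this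
        simpa using this
      · intro i g hg
        have hg' : φ g = 0 := hg
        change φ _ = 0
        rw [← derivation_aeval x (D i) i (hD i), show MvPolynomial.aeval x g = 0 from hg', map_zero]
  exact ⟨d, ⟨((Ideal.quotientEquivAlgOfEq k hker).trans
    (Ideal.quotientKerAlgEquivOfSurjective hφ)).symm⟩⟩

end Commutative

/-! ### Commutators and `p`-th powers in strictly graded bialgebras -/

section Graded

variable {k : Type u} {A : Type v} [Field k] [Ring A] [Bialgebra k A]

/-- A graded connected bialgebra whose primitive elements all have degree at most `1`: the common
setting for coradically graded Hopf algebras and for associated graded Hopf algebras. That the sum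
of the components is direct is not needed. -/
structure IsStrictlyGraded (G : ℕ → Submodule k A) : Prop where
  iSup_eq_top : ⨆ n, G n = ⊤
  exists_smul_one : ∀ x ∈ G 0, ∃ c : k, x = c • (1 : A)
  mul_mem : ∀ {i j : ℕ} {x y : A}, x ∈ G i → y ∈ G j → x * y ∈ G (i + j)
  comul_mem : ∀ {n : ℕ} {x : A}, x ∈ G n →
    Coalgebra.comul (R := k) x ∈ ⨆ i : ℕ, ⨆ j : ℕ, ⨆ _ : i + j = n, tensorSub (G i) (G j)
  counit_eq_zero : ∀ {n : ℕ} {x : A}, n ≠ 0 → x ∈ G n → Coalgebra.counit (R := k) x = 0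
  eq_zero_of_primitive : ∀ {n : ℕ} {x : A}, 2 ≤ n → x ∈ G n →
    Coalgebra.comul (R := k) x = x ⊗ₜ[k] 1 + 1 ⊗ₜ[k] x → x = 0

/-- The sum of the `G i ⊗ G j` with `i + j = n` and `i, j > 0`. -/
def middle (G : ℕ → Submodule k A) (n : ℕ) : Submodule k (A ⊗[k] A) :=
  ⨆ q : {q : ℕ × ℕ // q.1 + q.2 = n ∧ 0 < q.1 ∧ 0 < q.2}, tensorSub (G q.1.1) (G q.1.2)

lemma middle_le {G : ℕ → Submodule k A} {n : ℕ} {Z : Submodule k (A ⊗[k] A)}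
    (h : ∀ i j, i + j = n → 0 < i → 0 < j → ∀ u ∈ G i, ∀ v ∈ G j, u ⊗ₜ[k] v ∈ Z) :
    middle G n ≤ Z := by
  refine iSup_le ?_
  rintro ⟨⟨i, j⟩, hij, hi, hj⟩
  exact tensorSub_le (h i j hij hi hj)

lemma commute_middle {G : ℕ → Submodule k A} {m n : ℕ}
    (ih : ∀ i j x y, i + j < m + n → x ∈ G i → y ∈ G j → Commute x y)
    {s t : A ⊗[k] A} (hs : s ∈ middle G m) (ht : t ∈ middle G n) : Commute s t := by
  have key : middle G n ≤ Subalgebra.toSubmodule (Subalgebra.centralizer k {s}) := by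
    refine middle_le fun i' j' h' hi' hj' u' hu' v' hv' => ?_
    have : middle G m ≤ Subalgebra.toSubmodule (Subalgebra.centralizer k {u' ⊗ₜ[k] v'}) := by
      refine middle_le fun i j h hi hj u hu v hv => ?_
      refine Subalgebra.mem_centralizer_iff k |>.2 ?_
      rintro _ rfl
      rw [Algebra.TensorProduct.tmul_mul_tmul, Algebra.TensorProduct.tmul_mul_tmul,
        (ih i i' u u' (by omega) hu hu').eq, (ih j j' v v' (by omega) hv hv').eq]
    refine Subalgebra.mem_centralizer_iff k |>.2 ?_
    rintro _ rfl
    exact ((Subalgebra.mem_centralizer_iff k).1 (this hs) _ rfl).symm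
  exact (Subalgebra.mem_centralizer_iff k).1 (key ht) s rfl

lemma commute_tmul_one_middle {G : ℕ → Submodule k A} {m n : ℕ}
    (ih : ∀ i j x y, i + j < m + n → x ∈ G i → y ∈ G j → Commute x y)
    {x : A} (hx : x ∈ G m) {t : A ⊗[k] A} (ht : t ∈ middle G n) :
    Commute (x ⊗ₜ[k] (1 : A) + (1 : A) ⊗ₜ[k] x) t := by
  have key : middle G n ≤
      Subalgebra.toSubmodule (Subalgebra.centralizer k {x ⊗ₜ[k] (1 : A) + (1 : A) ⊗ₜ[k] x}) := by
    refine middle_le fun i j h hi hj u hu v hv => ?_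
    refine Subalgebra.mem_centralizer_iff k |>.2 ?_
    rintro _ rfl
    rw [add_mul, mul_add, Algebra.TensorProduct.tmul_mul_tmul, Algebra.TensorProduct.tmul_mul_tmul,
      Algebra.TensorProduct.tmul_mul_tmul, Algebra.TensorProduct.tmul_mul_tmul,
      (ih m i x u (by omega) hx hu).eq, (ih m j x v (by omega) hx hv).eq]
    simp only [one_mul, mul_one]
  exact (Subalgebra.mem_centralizer_iff k).1 (key ht) _ rfl

namespace IsStrictlyGraded

variable {G : ℕ → Submodule k A} (hG : IsStrictlyGraded G)
include hG

/-- Counitality forces the components of `Δ(x)` of bidegree `(n, 0)` and `(0, n)` to be `x ⊗ 1` and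
`1 ⊗ x`. -/
lemma exists_comul_eq_add_middle {n : ℕ} (hn : n ≠ 0) {x : A} (hx : x ∈ G n) :
    ∃ w ∈ middle G n, Coalgebra.comul (R := k) x = x ⊗ₜ[k] 1 + 1 ⊗ₜ[k] x + w := by
  let f : A →ₗ[k] A ⊗[k] A := (TensorProduct.mk k A A).flip 1
  let g : A →ₗ[k] A ⊗[k] A := TensorProduct.mk k A A 1
  have hle : (⨆ i : ℕ, ⨆ j : ℕ, ⨆ _ : i + j = n, tensorSub (G i) (G j)) ≤
      ((G n).map f ⊔ (G n).map g) ⊔ middle G n := by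
    refine iSup_le fun i => iSup_le fun j => iSup_le fun hij => ?_
    rcases Nat.eq_zero_or_pos i with rfl | hi
    · refine le_sup_of_le_left (le_sup_of_le_right (tensorSub_le fun u hu v hv => ?_))
      obtain ⟨c, rfl⟩ := hG.exists_smul_one u hu
      rw [zero_add] at hij
      subst hij
      exact ⟨c • v, Submodule.smul_mem _ _ hv, by simp [g, TensorProduct.smul_tmul]⟩
    · rcases Nat.eq_zero_or_pos j with rfl | hj
      · refine le_sup_of_le_left (le_sup_of_le_left (tensorSub_le fun u hu v hv => ?_))
        obtain ⟨c, rfl⟩ := hG.exists_smul_one v hv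
        rw [add_zero] at hij
        subst hij
        exact ⟨c • u, Submodule.smul_mem _ _ hu, by simp [f]⟩
      · refine le_sup_of_le_right ?_
        exact le_iSup (fun q : {q : ℕ × ℕ // q.1 + q.2 = n ∧ 0 < q.1 ∧ 0 < q.2} =>
          tensorSub (G q.1.1) (G q.1.2)) ⟨(i, j), hij, hi, hj⟩
  obtain ⟨t, ht, w, hw, hx'⟩ := Submodule.mem_sup.1 (hle (hG.comul_mem hx))
  obtain ⟨_, ⟨b, hb, rfl⟩, _, ⟨a, ha, rfl⟩, rfl⟩ := Submodule.mem_sup.1 ht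
  have hl : middle G n ≤ LinearMap.ker ((Coalgebra.counit (R := k)).rTensor A) :=
    middle_le fun i j _ hi _ u hu v _ => by simp [hG.counit_eq_zero hi.ne' hu]
  have hr : middle G n ≤ LinearMap.ker ((Coalgebra.counit (R := k)).lTensor A) :=
    middle_le fun i j _ _ hj u _ v hv => by simp [hG.counit_eq_zero hj.ne' hv]
  have h1 := congrArg (fun t => TensorProduct.lid k A ((Coalgebra.counit (R := k)).rTensor A t)) hx'
  have h2 := congrArg (fun t => TensorProduct.rid k A ((Coalgebra.counit (R := k)).lTensor A t)) hx'
  simp only [map_add, LinearMap.mem_ker.1 (hl hw), LinearMap.mem_ker.1 (hr hw),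
    Coalgebra.rTensor_counit_comul, Coalgebra.lTensor_counit_comul] at h1 h2
  simp [f, g, hG.counit_eq_zero hn ha, hG.counit_eq_zero hn hb] at h1 h2
  refine ⟨w, hw, ?_⟩
  rw [← hx', h1, h2]
  rfl

/-- The commutator of homogeneous elements of positive degree is primitive as soon as elements of
smaller total degree commute, so it vanishes. -/
lemma commute {m n : ℕ} {x y : A} (hx : x ∈ G m) (hy : y ∈ G n) : Commute x y := by
  induction hN : m + n using Nat.strong_induction_on generalizing m n x y with
  | _ N ih =>
  subst hN
  rcases eq_or_ne m 0 with rfl | hm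
  · obtain ⟨c, rfl⟩ := hG.exists_smul_one x hx
    exact (Commute.one_left y).smul_left c
  rcases eq_or_ne n 0 with rfl | hn
  · obtain ⟨c, rfl⟩ := hG.exists_smul_one y hy
    exact (Commute.one_right x).smul_right c
  have ih' : ∀ i j x y, i + j < m + n → x ∈ G i → y ∈ G j → Commute x y :=
    fun i j x y h hx hy => ih (i + j) h hx hy rfl
  have ih'' : ∀ i j x y, i + j < n + m → x ∈ G i → y ∈ G j → Commute x y :=
    fun i j x y h hx hy => ih (i + j) (by omega) hx hy rfl
  obtain ⟨s, hs, hxs⟩ := hG.exists_comul_eq_add_middle hm hx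
  obtain ⟨t, ht, hyt⟩ := hG.exists_comul_eq_add_middle hn hy
  refine sub_eq_zero.1 (hG.eq_zero_of_primitive (n := m + n) (by omega)
    (sub_mem (hG.mul_mem hx hy) (add_comm n m ▸ hG.mul_mem hy hx)) ?_)
  rw [map_sub, Bialgebra.comul_mul, Bialgebra.comul_mul, hxs, hyt]
  have h1 := (commute_tmul_one_middle ih' hx ht).eq
  have h2 := (commute_tmul_one_middle ih'' hy hs).eq
  have h3 := (commute_middle ih' hs ht).eq
  have e (X Y s t : A ⊗[k] A) (h1 : X * t = t * X) (h2 : Y * s = s * Y) (h3 : s * t = t * s) :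
      (X + s) * (Y + t) - (Y + t) * (X + s) = X * Y - Y * X := by
    simp only [add_mul, mul_add, h1, h2, h3]
    abel
  rw [e _ _ s t h1 h2 h3]
  simp only [add_mul, mul_add, Algebra.TensorProduct.tmul_mul_tmul, one_mul, mul_one,
    TensorProduct.sub_tmul, TensorProduct.tmul_sub]
  abel

/-- A graded connected bialgebra with all primitives in degree at most `1` is commutative. -/
theorem mul_comm (a b : A) : a * b = b * a := by
  have h1 : ⨆ n, G n ≤ Subalgebra.toSubmodule (Subalgebra.centralizer k {a}) := by
    refine iSup_le fun n y hy => ?_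
    have h2 : ⨆ n, G n ≤ Subalgebra.toSubmodule (Subalgebra.centralizer k {y}) := by
      refine iSup_le fun m x hx => (Subalgebra.mem_centralizer_iff k).2 ?_
      rintro _ rfl
      exact hG.commute hy hx
    rw [hG.iSup_eq_top] at h2
    refine (Subalgebra.mem_centralizer_iff k).2 ?_
    rintro _ rfl
    exact ((Subalgebra.mem_centralizer_iff k).1 (h2 Submodule.mem_top) _ rfl).symm
  rw [hG.iSup_eq_top] at h1
  exact (Subalgebra.mem_centralizer_iff k).1 (h1 Submodule.mem_top) _ rfl

end IsStrictlyGraded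

end Graded

section CommGraded

variable {k : Type u} {A : Type v} [Field k] [CommRing A] [Bialgebra k A]
  {G : ℕ → Submodule k A}

/-- By induction on the degree the middle terms of `Δ(x)` have zero `p`-th power. As Frobenius is
additive on `A ⊗ A`, the element `x ^ p`, which has degree at least `2`, is primitive, hence zero. -/
lemma IsStrictlyGraded.pow_eq_zero_of_mem (hG : IsStrictlyGraded G) (p : ℕ) [Fact p.Prime]
    [CharP k p] {n : ℕ} (hn : n ≠ 0) {x : A} (hx : x ∈ G n) : x ^ p = 0 := by
  have : Nontrivial (A ⊗[k] A) := by
    refine ⟨0, 1, fun h => ?_⟩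
    have := congrArg ((Coalgebra.counit (R := k)) ∘ₗ LinearMap.mul' k A) h
    simp [Algebra.TensorProduct.one_def] at this
  have : CharP (A ⊗[k] A) p := charP_of_injective_algebraMap (algebraMap k (A ⊗[k] A)).injective p
  have hp : p.Prime := Fact.out
  induction n using Nat.strong_induction_on generalizing x with
  | _ n ih =>
  obtain ⟨w, hw, hxw⟩ := hG.exists_comul_eq_add_middle hn hx
  let Z : Submodule k (A ⊗[k] A) :=
    { carrier := {w | w ^ p = 0}
      add_mem' := fun {a b} ha hb => by
        rw [Set.mem_ofPred_eq] at ha hb ⊢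
        rw [add_pow_char, ha, hb, add_zero]
      zero_mem' := zero_pow hp.ne_zero
      smul_mem' := fun c a ha => by
        rw [Set.mem_ofPred_eq] at ha ⊢
        rw [smul_pow, ha, smul_zero] }
  have hZ : middle G n ≤ Z := middle_le fun i j hij hi hj u hu v hv => by
    change (u ⊗ₜ[k] v) ^ p = 0
    rw [Algebra.TensorProduct.tmul_pow, ih i (by omega) hi.ne' hu, TensorProduct.zero_tmul]
  have hw0 : w ^ p = 0 := hZ hw
  have hmem (r : ℕ) : x ^ (r + 1) ∈ G ((r + 1) * n) := by
    induction r with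
    | zero => simpa using hx
    | succ r ihr => rw [pow_succ, add_mul (r + 1), one_mul]; exact hG.mul_mem ihr hx
  obtain ⟨r, rfl⟩ : ∃ r, p = r + 1 := ⟨p - 1, (Nat.succ_pred hp.ne_zero).symm⟩
  refine hG.eq_zero_of_primitive ?_ (hmem r) ?_
  · exact hp.two_le.trans (Nat.le_mul_of_pos_right _ (Nat.pos_of_ne_zero hn))
  · rw [Bialgebra.comul_pow, hxw, add_pow_char, add_pow_char, hw0, add_zero,
      Algebra.TensorProduct.tmul_pow, Algebra.TensorProduct.tmul_pow, one_pow]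

lemma IsStrictlyGraded.pow_eq_zero (hG : IsStrictlyGraded G) (p : ℕ) [Fact p.Prime]
    [CharP k p] {a : A} (ha : Coalgebra.counit (R := k) a = 0) : a ^ p = 0 := by
  have hp : p.Prime := Fact.out
  have : Nontrivial A := by
    refine ⟨0, 1, fun h => ?_⟩
    have := congrArg (Coalgebra.counit (R := k)) h
    simp at this
  have : CharP A p := charP_of_injective_algebraMap (algebraMap k A).injective p
  -- The `p`-th power map and `a ↦ ε(a) ^ p` are additive and agree on each component.
  have h (a : A) : a ^ p = algebraMap k A (Coalgebra.counit a ^ p) := by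
    have ha : a ∈ ⨆ n, G n := hG.iSup_eq_top ▸ Submodule.mem_top
    refine Submodule.iSup_induction G (motive := fun a => a ^ p = algebraMap k A
      (Coalgebra.counit a ^ p)) ha (fun n x hx => ?_) (by simp [hp.ne_zero]) fun x y hx hy => ?_
    · rcases eq_or_ne n 0 with rfl | hn
      · obtain ⟨c, rfl⟩ := hG.exists_smul_one x hx
        simp [Algebra.smul_def]
      · rw [hG.pow_eq_zero_of_mem p hn hx, hG.counit_eq_zero hn hx, zero_pow hp.ne_zero, map_zero]
    · rw [add_pow_char, hx, hy, map_add, add_pow_char, map_add]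
  rw [h, ha, zero_pow hp.ne_zero, map_zero]

end CommGraded

/-- A finite-dimensional strictly graded bialgebra in characteristic `p` is a truncated polynomial
algebra. -/
theorem IsStrictlyGraded.nonempty_algEquiv_truncPoly {k : Type u} {A : Type v} [Field k] [Ring A]
    [Bialgebra k A] [FiniteDimensional k A] {G : ℕ → Submodule k A} (hG : IsStrictlyGraded G)
    (p : ℕ) [Fact p.Prime] [CharP k p] : ∃ d : ℕ, Nonempty (A ≃ₐ[k] TruncPoly k p d) := by
  let _ : CommRing A := { ‹Ring A› with mul_comm := hG.mul_comm }
  exact ConnHopf.nonempty_algEquiv_truncPoly p fun a ha => hG.pow_eq_zero p ha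

/-! ### Primitive elements of the associated graded coalgebra -/

section AssociatedGraded

variable {k : Type u} {C : Type v} [Field k] [AddCommGroup C] [Module k C] [Coalgebra k C]

lemma symb_mem_range (n : ℕ) (x : C) :
    symb k C n x ∈ LinearMap.range (DirectSum.lof k ℕ (GrComp k C) n) := ⟨_, rfl⟩

lemma exists_symb_of_mem_range {n : ℕ} {a : Gr k C}
    (ha : a ∈ LinearMap.range (DirectSum.lof k ℕ (GrComp k C) n)) :
    ∃ x ∈ corad k C n, a = symb k C n x := by
  obtain ⟨y, rfl⟩ := ha
  obtain ⟨x, rfl⟩ := grMk_surjective _ y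
  exact ⟨x, x.2, (symb_apply x).symm⟩

lemma component_symb_of_ne {m n : ℕ} (h : m ≠ n) (x : C) :
    DirectSum.component k ℕ (GrComp k C) m (symb k C n x) = 0 := by
  exact DirectSum.of_eq_of_ne _ _ _ h

variable (k C) in
/-- The inclusion `Cₙ / Cₙ₋₁ → C / Cₙ₋₁`, where `C₋₁ = 0`. -/
def grInclusion (n : ℕ) : GrComp k C n →ₗ[k] C ⧸ coradPred k C n :=
  grLift k C n ((coradPred k C n).mkQ ∘ₗ (corad k C n).subtype)
    fun _ hx => (Submodule.Quotient.mk_eq_zero _).2 hx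

lemma grInclusion_component_symb {n : ℕ} {x : C} (hx : x ∈ corad k C n) :
    grInclusion k C n (DirectSum.component k ℕ (GrComp k C) n (symb k C n x)) =
      (coradPred k C n).mkQ x := by
  have h := symb_apply (⟨x, hx⟩ : corad k C n)
  simp only at h
  rw [h, DirectSum.component.lof_self]
  rfl

/-- The class of `Δ(x)` in `C / Cᵢ₋₁ ⊗ C / Cⱼ₋₁` is the component of bidegree `(i, j)` of the
comultiplication of `gr C` at the class of `x`. -/
lemma mkQ_tmul_mkQ_comul {i j : ℕ} {x : C} (hx : x ∈ corad k C (i + j)) :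
    TensorProduct.map (coradPred k C i).mkQ (coradPred k C j).mkQ (Coalgebra.comul (R := k) x) =
      TensorProduct.map (grInclusion k C i ∘ₗ DirectSum.component k ℕ (GrComp k C) i)
        (grInclusion k C j ∘ₗ DirectSum.component k ℕ (GrComp k C) j)
        (Coalgebra.comul (R := k) (symb k C (i + j) x)) := by
  change _ = TensorProduct.map _ _ (grComul k C _)
  rw [grComul_symb hx]
  refine comul_ext (TensorProduct.map (coradPred k C i).mkQ (coradPred k C j).mkQ)
    (TensorProduct.map (grInclusion k C i ∘ₗ DirectSum.component k ℕ (GrComp k C) i)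
        (grInclusion k C j ∘ₗ DirectSum.component k ℕ (GrComp k C) j) ∘ₗ symb₂ k C (i + j)) ?_ hx
  intro a b hab u hu v hv
  rw [LinearMap.comp_apply, ← hab, symb₂_tmul hu hv, TensorProduct.map_tmul, TensorProduct.map_tmul,
    LinearMap.comp_apply, LinearMap.comp_apply]
  rcases lt_trichotomy a i with h | rfl | h
  · rw [component_symb_of_ne h.ne', map_zero, TensorProduct.zero_tmul]
    have : (coradPred k C i).mkQ u = 0 := (Submodule.Quotient.mk_eq_zero _).2
      (coradPred_mono (show a + 1 ≤ i from h) hu)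
    rw [this, TensorProduct.zero_tmul]
  · obtain rfl : b = j := by omega
    rw [grInclusion_component_symb hu, grInclusion_component_symb hv]
  · have hb : b < j := by omega
    rw [component_symb_of_ne hb.ne', map_zero, TensorProduct.tmul_zero]
    have : (coradPred k C j).mkQ v = 0 := (Submodule.Quotient.mk_eq_zero _).2
      (coradPred_mono (show b + 1 ≤ j from hb) hv)
    rw [this, TensorProduct.tmul_zero]

end AssociatedGraded

/-! ### Coradically graded Hopf algebras and associated graded Hopf algebras -/

section Coradical

variable {k : Type u} {H : Type v} [Field k] [Ring H] [HopfAlgebra k H] [IsConnectedCoalgebra k H]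

lemma mem_corad_one_of_primitive {A : Type v} [Ring A] [Bialgebra k A] {x : A}
    (hx : Coalgebra.comul (R := k) x = x ⊗ₜ[k] 1 + 1 ⊗ₜ[k] x) : x ∈ corad k A 1 := by
  change Coalgebra.comul (R := k) x ∈ tensorSub (corad k A 0) ⊤ ⊔ tensorSub ⊤ (corad k A 0)
  rw [hx]
  exact add_mem (Submodule.mem_sup_right (tmul_mem_tensorSub trivial one_mem_corad))
    (Submodule.mem_sup_left (tmul_mem_tensorSub one_mem_corad trivial))

lemma IsCoradicallyGradedHopfAlgebra.isStrictlyGraded {G : ℕ → Submodule k H}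
    (hG : IsCoradicallyGradedHopfAlgebra G) : IsStrictlyGraded G where
  iSup_eq_top := hG.isInternal.submodule_iSup_eq_top
  exists_smul_one x hx := by
    refine exists_smul_one (A := H) ?_
    rw [hG.corad_eq]
    exact le_iSup₂ (f := fun m (_ : m ≤ 0) => G m) 0 le_rfl hx
  mul_mem := hG.mul_mem
  comul_mem := hG.comul_mem
  counit_eq_zero := hG.counit_eq_zero
  eq_zero_of_primitive {n x} hn hx hprim := by
    have h1 := mem_corad_one_of_primitive hprim
    rw [hG.corad_eq] at h1
    have hd := hG.isInternal.submodule_iSupIndep n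
    refine Submodule.disjoint_def.1 hd x hx (SetLike.le_def.1 ?_ h1)
    exact iSup₂_le fun m hm => le_iSup₂ (f := fun m (_ : m ≠ n) => G m) m (by omega)

/-- A primitive element of `gr H` of degree `n ≥ 2` is zero: its comultiplication has no component of
bidegree `(1, n - 1)`, so a representative in `Hₙ` lies in the wedge of `H₀` and `Hₙ₋₂`, which is
`Hₙ₋₁`. -/
lemma symb_eq_zero_of_primitive {n : ℕ} (hn : 2 ≤ n) {x : H} (hx : x ∈ corad k H n)
    (h : Coalgebra.comul (R := k) (symb k H n x) =
      symb k H n x ⊗ₜ[k] 1 + 1 ⊗ₜ[k] symb k H n x) : symb k H n x = 0 := by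
  obtain ⟨m, rfl⟩ : ∃ m, n = 1 + (m + 1) := ⟨n - 2, by omega⟩
  refine symb_eq_zero_of_mem ?_
  have hw : wedge (coradPred k H 1) (coradPred k H (m + 1)) = coradPred k H (1 + (m + 1)) := by
    rw [add_comm 1 (m + 1)]
    rfl
  rw [← hw, mem_wedge, mkQ_tmul_mkQ_comul hx, h, map_add, TensorProduct.map_tmul,
    TensorProduct.map_tmul, ← symb_one]
  simp only [LinearMap.comp_apply]
  rw [component_symb_of_ne (m := 1) (n := 1 + (m + 1)) (by omega),
    component_symb_of_ne (m := 1) (n := 0) (by omega)]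
  simp

variable (k H) in
lemma isStrictlyGraded_gr : IsStrictlyGraded
    fun n => LinearMap.range (DirectSum.lof k ℕ (GrComp k H) n) where
  iSup_eq_top := by
    refine eq_top_iff.2 fun a _ => ?_
    induction a using DirectSum.induction_on with
    | zero => exact zero_mem _
    | add a b ha hb => exact add_mem (ha trivial) (hb trivial)
    | of n y => exact Submodule.mem_iSup_of_mem n ⟨y, rfl⟩
  exists_smul_one a ha := by
    obtain ⟨x, hx, rfl⟩ := exists_symb_of_mem_range ha
    obtain ⟨c, rfl⟩ := exists_smul_one hx
    exact ⟨c, by rw [map_smul, symb_one]⟩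
  mul_mem {i j a b} ha hb := by
    obtain ⟨x, hx, rfl⟩ := exists_symb_of_mem_range ha
    obtain ⟨y, hy, rfl⟩ := exists_symb_of_mem_range hb
    rw [← symb_mul hx hy]
    exact symb_mem_range _ _
  comul_mem {n a} ha := by
    obtain ⟨x, hx, rfl⟩ := exists_symb_of_mem_range ha
    change grComul k H _ ∈ _
    rw [grComul_symb hx]
    refine comul_mem_of (Z := Submodule.comap (symb₂ k H n) (⨆ i : ℕ, ⨆ j : ℕ, ⨆ _ : i + j = n,
      tensorSub (LinearMap.range (DirectSum.lof k ℕ (GrComp k H) i))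
        (LinearMap.range (DirectSum.lof k ℕ (GrComp k H) j)))) ?_ hx
    rintro i j rfl u hu v hv
    rw [Submodule.mem_comap, symb₂_tmul hu hv]
    refine Submodule.mem_iSup_of_mem i (Submodule.mem_iSup_of_mem j
      (Submodule.mem_iSup_of_mem rfl (tmul_mem_tensorSub ?_ ?_)))
    · exact symb_mem_range _ _
    · exact symb_mem_range _ _
  counit_eq_zero {n a} hn ha := by
    obtain ⟨x, hx, rfl⟩ := exists_symb_of_mem_range ha
    exact grCounit_symb hn hx
  eq_zero_of_primitive {n a} hn ha h := by
    obtain ⟨x, hx, rfl⟩ := exists_symb_of_mem_range ha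
    exact symb_eq_zero_of_primitive hn hx h

variable (k H) in
/-- The coradical filtration is stationary, so only finitely many components of `gr H` are
nonzero. -/
lemma finiteDimensional_gr [FiniteDimensional k H] : FiniteDimensional k (Gr k H) := by
  obtain ⟨N, hN⟩ := monotone_stabilizes_iff_noetherian.2 (inferInstance : IsNoetherian k H)
    ⟨corad k H, corad_mono⟩
  have hfin (n : ℕ) : FiniteDimensional k (GrComp k H n) :=
    inferInstanceAs (FiniteDimensional k
      (corad k H n ⧸ (coradPred k H n).submoduleOf (corad k H n)))
  have hzero {n : ℕ} (hn : N < n) (x : corad k H n) : symb k H n x = 0 := by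
    refine symb_eq_zero hn ?_
    have h := hN n hn.le
    simp only [OrderHom.coe_mk] at h
    rw [h]
    exact x.2
  have htop : (⊤ : Submodule k (Gr k H)) =
      ⨆ n : Fin (N + 1), LinearMap.range (DirectSum.lof k ℕ (GrComp k H) n) := by
    refine le_antisymm ?_ le_top
    rw [← (isStrictlyGraded_gr k H).iSup_eq_top]
    refine iSup_le fun n a ha => ?_
    obtain ⟨x, hx, rfl⟩ := exists_symb_of_mem_range ha
    rcases lt_or_ge N n with h | h
    · rw [hzero h ⟨x, hx⟩]
      exact zero_mem _
    · exact Submodule.mem_iSup_of_mem (⟨n, Nat.lt_succ_of_le h⟩ : Fin (N + 1))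
        (symb_mem_range _ _)
  rw [FiniteDimensional, Module.finite_def, htop]
  exact Submodule.fg_iSup _ fun n => Module.Finite.iff_fg.1 inferInstance

end Coradical
end ConnHopf

theorem theorem3p1 {k : Type*} [Field k] [IsAlgClosed k] (p : ℕ) [Fact p.Prime] [CharP k p]
    {H : Type*} [Ring H] [HopfAlgebra k H] [FiniteDimensional k H]
    [ConnHopf.IsConnectedCoalgebra k H] :
    (∀ G : ℕ → Submodule k H, ConnHopf.IsCoradicallyGradedHopfAlgebra G →
      ∃ d : ℕ, Nonempty (H ≃ₐ[k] ConnHopf.TruncPoly k p d)) ∧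
    (∃ d : ℕ, Nonempty (ConnHopf.Gr k H ≃ₐ[k] ConnHopf.TruncPoly k p d)) ∧
    (∀ a b : ConnHopf.Gr k H, a * b = b * a) := by
  have := ConnHopf.finiteDimensional_gr k H
  have hGr := ConnHopf.isStrictlyGraded_gr k H
  exact ⟨fun G hG => hG.isStrictlyGraded.nonempty_algEquiv_truncPoly p,
    hGr.nonempty_algEquiv_truncPoly p, hGr.mul_comm⟩
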